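/- Let $p>q\ge 2$ be integers and, for $c\in\mathbb C$, let $\mathbf f_c$ be the correspondence $z\mapsto w$ given by $(w-c)^q=z^p$. A *branch* of $\mathbf f_c$ at $z$ is a holomorphic function $\varphi$ near $z$ with $(\varphi(x)-c)^q=x^p$. **Hyperbolic sets.** A nonempty compact set $\Lambda\subset\mathbb C\setminus\{0\}$ is *semi-invariant* if every point of $\Lambda$ has an image and a pre-image in $\Lambda$ under $\mathbf f_c$. A semi-invariant $\Lambda$ is an *expanding* (resp. *attracting*) *hyperbolic set* of $\mathbf f_c$ if there are a region $V\supset\Lambda$ and a continuous conformal metric $\mu(z)|dz|$, $\mu>0$, on $V$ such that $\inf\|\varphi'(z)\|_\mu>1$ (resp. $\sup\|\varphi'(z)\|_\mu<1$), over all $z\in V$ and all branches $\varphi$ at $z$ with $\varphi(z)\in V$, where $\|\varphi'(z)\|_\mu=|\varphi'(z)|\mu(\varphi(z))/\mu(z)$. Put $\epsilon=1$ if $\Lambda$ is expanding and $\epsilon=-1$ if $\Lambda$ is attracting. **Cantor bundles.** Let $A_r=\{r<|z|<1/(2r)\}$. A pair $(r,\delta)$ is *admissible* for $(c,\Lambda)$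 if $0<r<1/\sqrt2$, $4|c|r<1$, $\delta>0$, $\Lambda\subset A_r\cap(c+A_r)$, and for all $z\in\Lambda$ the closed disks of radius $\delta$ about the points of $r(\mathbf f_c(z)\cap\Lambda)$ are pairwise disjoint and contained in the open unit disk $\mathbb D$, and likewise for $r(\mathbf f_c^{-1}(z)\cap\Lambda)$. For $z\in\Lambda$ let $\mathcal D_n(z)$ be the union of the disks $r(z_1+\delta z_2+\dots+\delta^{n-1}z_n)+\delta^n\overline{\mathbb D}$ over all infinite orbits $z=z_0,z_1,z_2,\dots$ of $\mathbf f_c^{\epsilon}$ in $\Lambda$, and let $\mathcal B_{r,\delta}(\Lambda)=\{(z,s): z\in\Lambda,\ s\in\bigcap_{n>0}\mathcal D_n(z)\}\subset\mathbb C^2$, with projection $\pi(z,s)=z$. The *bundle map* $f_c$ of $\mathcal B_{r,\delta}(\Lambda)$ is $f_c(z,s)=(z_1,\delta^{-1}s-r\delta^{-1}z_1)$, where $z_1$ is the unique point of $\mathbf f_c^{\epsilon}(z)\cap\Lambda$ with $s\in rz_1+\delta\overline{\mathbb D}$. For two admissible pairs let $\Phi:\mathcal B_{r,\delta}(\Lambda)\to\mathcal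 B_{r',\delta'}(\Lambda)$ be $\Phi(x)=\bigl(\pi(x),\ r'\sum_{n\ge1}\delta'^{\,n-1}\pi f_c^n(x)\bigr)$. **Bundle motions and induced multifunctions.** Let $\Lambda$ be a hyperbolic set of $\mathbf f_{c_0}$ and $(r,\delta)$ admissible for $(c_0,\Lambda)$. An *$(r,\delta)$-bundle motion* on a bounded domain $U\ni c_0$ is a map $h:U\times\mathcal B_{r,\delta}(\Lambda)\to\mathbb C^2$, $h_c=h(c,\cdot)$, such that $h_{c_0}=\mathrm{id}$, each $h_c$ is injective, each $h(\cdot,x)$ is holomorphic, and 1. for each $c\in U$, $\Lambda_c=\pi h_c(\mathcal B_{r,\delta}(\Lambda))$ is a hyperbolic set of $\mathbf f_c$ of the same type (expanding or attracting) as $\Lambda$, $(r,\delta)$ is admissible for $(c,\Lambda_c)$, and $c\mapsto\Lambda_c$ is continuous on $U$ in the Hausdorff metric; 2. for each $c\in U$, the image of $h_c$ is a subset of $\mathcal B_{r,\delta}(\Lambda_c)$ invariant under its bundle map $f_c$, and $h_c\circ f_{c_0}=f_c\circ h_c$; 3. there is $C>0$ with $|h_u(x)-h_v(x)|\le C|u-v|$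 for all $u,v\in U$ and all $x$. A *solenoidal extension* $[S,\Lambda]$ is a set $S\subset\mathcal B_{r,\delta}(\Lambda)$ with $f_{c_0}(S)\subset S$ and $\pi(S)=\Lambda$. With a bundle motion $h$ on $U$, it *induces* the multifunction $\mathbf h(c,z)=\pi\circ h_c\circ(\pi|_S)^{-1}(z)$ on $U\times\Lambda$. **Normal branched holomorphic motions.** A multifunction $\mathbf h$ (with nonempty values) on $U\times A$, $U\subset\mathbb C$ a domain, is a *normal branched holomorphic motion* with base point $c_0\in U$ if $\mathbf h(c_0,z)=\{z\}$ for $z\in A$, and $\bigcup_{z\in A}\bigcup_{c\in U}\{c\}\times\mathbf h(c,z)$ is the union of the graphs of a family $\mathcal F$ of holomorphic functions $U\to\mathbb C$ that is normal (every sequence in $\mathcal F$ has a subsequence converging locally uniformly on $U$). **Theorem.** Let $\Lambda$ be a hyperbolic set of $\mathbf f_{c_0}$, let $(r,\delta)$ be admissible for $(c_0,\Lambda)$, and let $[S,\Lambda]$ be a solenoidal extension, $S\subset\mathcal B_{r,\delta}(\Lambda)$. * There is an $(r,\delta)$-bundle motion on some bounded domain $U\ni c_0$. For every such motion, the induced multifunction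 $\mathbf h$ is a normal branched holomorphic motion on $U\times\Lambda$ with base point $c_0$. * (Independence of $(r,\delta)$.) Let $(r',\delta')$ also be admissible for $(c_0,\Lambda)$. Then $[\Phi(S),\Lambda]$ is a solenoidal extension with $\Phi(S)\subset\mathcal B_{r',\delta'}(\Lambda)$. If there is an $(r,\delta)$-bundle motion on $U$ for which $(r',\delta')$ is admissible for $(c,\Lambda_c)$ for every $c\in U$, then there is also an $(r',\delta')$-bundle motion on $U$. If $\mathbf h$ is induced by $S$ and an $(r,\delta)$-bundle motion on $U$, and $\mathbf h'$ by $\Phi(S)$ and an $(r',\delta')$-bundle motion on $U'$, then $\mathbf h=\mathbf h'$ on $W\times\Lambda$ for every connected set $W$ with $c_0\in W\subset U\cap U'$. * (Uniqueness.) If $\mathbf h$ and $\mathbf h'$ are induced by $S$ and $(r,\delta)$-bundle motions on $U$ and $U'$, then $\mathbf h=\mathbf h'$ on $W\times\Lambda$ for every connected set $W$ with $c_0\in W\subset U\cap U'$. In particular $\mathbf h$ is determined by $U$, and if $U\subset U'$ then $\mathbf h'$ extends $\mathbf h$. -/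

import Mathlib

open Set Filter Topology Metric

noncomputable section

namespace PowerCorr

/-! ### The correspondence `(w - c)^q = z^p` and its hyperbolic sets -/

/-- `CorrRel p q c z w` says that `w` is an image of `z` under the correspondence `𝐟_c`. -/
def CorrRel (p q : ℕ) (c z w : ℂ) : Prop := (w - c) ^ q = z ^ p

/-- The two types of hyperbolic sets. -/
inductive HypKind where
  | expanding
  | attracting

/-- One step of `𝐟_c` (expanding type), or of `𝐟_c⁻¹` (attracting type). -/
def Step (p q : ℕ) : HypKind → ℂ → ℂ → ℂ → Prop
  | .expanding, c, z, w => CorrRel p q c z w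
  | .attracting, c, z, w => CorrRel p q c w z

/-- Nonempty compact subsets `Λ` of `ℂ \ {0}` that are semi-invariant: every point of `Λ` has at
least one image and at least one pre-image in `Λ`. -/
structure IsSemiInvariant (p q : ℕ) (c : ℂ) (Λ : Set ℂ) : Prop where
  nonempty : Λ.Nonempty
  compact : IsCompact Λ
  zero_notMem : (0 : ℂ) ∉ Λ
  image : ∀ z ∈ Λ, ∃ w ∈ Λ, CorrRel p q c z w
  preimage : ∀ z ∈ Λ, ∃ w ∈ Λ, CorrRel p q c w z

/-- `φ` is (the germ at `z` of) a holomorphic branch of `𝐟_c` defined in a neighbourhood of `z`. -/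
def IsBranchAt (p q : ℕ) (c : ℂ) (φ : ℂ → ℂ) (z : ℂ) : Prop :=
  ∀ᶠ x in 𝓝 z, DifferentiableAt ℂ φ x ∧ CorrRel p q c x (φ x)

/-- The norm of `φ'(z)` with respect to the conformal metric `μ(z)|dz|`. -/
def derivNorm (μ : ℂ → ℝ) (φ : ℂ → ℂ) (z : ℂ) : ℝ := ‖deriv φ z‖ * μ (φ z) / μ z

/-- The metric `μ(z)|dz|` on `V` is uniformly expanded (resp. contracted) by all branches `φ` of
`𝐟_c` at points `z ∈ V` with `φ z ∈ V`. -/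
def IsHyperbolicMetric (p q : ℕ) (c : ℂ) (V : Set ℂ) (μ : ℂ → ℝ) : HypKind → Prop
  | .expanding => ∃ l : ℝ, 1 < l ∧
      ∀ z ∈ V, ∀ φ : ℂ → ℂ, IsBranchAt p q c φ z → φ z ∈ V → l ≤ derivNorm μ φ z
  | .attracting => ∃ l : ℝ, l < 1 ∧
      ∀ z ∈ V, ∀ φ : ℂ → ℂ, IsBranchAt p q c φ z → φ z ∈ V → derivNorm μ φ z ≤ l

/-- `Λ` is a hyperbolic set of `𝐟_c` of the given type: it is semi-invariant, and some conformal
metric on a region `V ⊇ Λ` is uniformly expanded (resp. contracted). -/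
def IsHyperbolicSet (p q : ℕ) (k : HypKind) (c : ℂ) (Λ : Set ℂ) : Prop :=
  IsSemiInvariant p q c Λ ∧
    ∃ (V : Set ℂ) (μ : ℂ → ℝ), IsOpen V ∧ IsConnected V ∧ Λ ⊆ V ∧
      ContinuousOn μ V ∧ (∀ z ∈ V, 0 < μ z) ∧ IsHyperbolicMetric p q c V μ k

/-! ### Cantor bundles -/

/-- The annulus `r < |z| < 1/(2r)`. -/
def annulus (r : ℝ) : Set ℂ := {z | r < ‖z‖ ∧ ‖z‖ < 1 / (2 * r)}

/-- `(r, δ)` may be used to form the Cantor bundle of the semi-invariant set `Λ` of `𝐟_c`: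
`0 < r < min (1/√2) (1/(4|c|))`, `Λ` lies in `A_r ∩ (c + A_r)`, and, for each `z ∈ Λ`, the closed
disks of radius `δ` about the points of `r (𝐟_c(z) ∩ Λ)` are pairwise disjoint and lie in the unit
disk, and likewise for `r (𝐟_c⁻¹(z) ∩ Λ)`. -/
structure IsBundleScale (p q : ℕ) (c : ℂ) (Λ : Set ℂ) (r δ : ℝ) : Prop where
  r_pos : 0 < r
  r_lt : r < 1 / Real.sqrt 2
  r_mul_lt : 4 * ‖c‖ * r < 1
  δ_pos : 0 < δ
  subset_annulus : ∀ z ∈ Λ, z ∈ annulus r ∧ z - c ∈ annulus r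
  disjoint_disks : ∀ k : HypKind, ∀ z ∈ Λ, ∀ w ∈ Λ, ∀ w' ∈ Λ,
    Step p q k c z w → Step p q k c z w' → w ≠ w' →
      Disjoint (closedBall ((r : ℂ) * w) δ) (closedBall ((r : ℂ) * w') δ)
  disks_subset : ∀ k : HypKind, ∀ z ∈ Λ, ∀ w ∈ Λ, Step p q k c z w →
    closedBall ((r : ℂ) * w) δ ⊆ ball 0 1

/-- `x` is an infinite orbit in `Λ` starting at `z`: a forward orbit for the expanding type and a
backward orbit `⋯ → x 2 → x 1 → x 0 = z` for the attracting type. -/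
def IsOrbitFrom (p q : ℕ) (k : HypKind) (c : ℂ) (Λ : Set ℂ) (z : ℂ) (x : ℕ → ℂ) : Prop :=
  x 0 = z ∧ (∀ i, x i ∈ Λ) ∧ ∀ i, Step p q k c (x i) (x (i + 1))

/-- The set `𝒟_n(z)`: the union of the disks
`r (z_1 + δ z_2 + ⋯ + δ^(n-1) z_n) + δ^n 𝔻̄` over all orbits `z, z_1, z_2, …` in `Λ`. -/
def cantorDisks (p q : ℕ) (k : HypKind) (c : ℂ) (Λ : Set ℂ) (r δ : ℝ) (n : ℕ) (z : ℂ) : Set ℂ :=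
  {s | ∃ x : ℕ → ℂ, IsOrbitFrom p q k c Λ z x ∧
    s ∈ closedBall ((r : ℂ) * ∑ i ∈ Finset.range n, (δ : ℂ) ^ i * x (i + 1)) (δ ^ n)}

/-- The fibre `𝒞(z) = ⋂_{n > 0} 𝒟_n(z)`. -/
def cantorFiber (p q : ℕ) (k : HypKind) (c : ℂ) (Λ : Set ℂ) (r δ : ℝ) (z : ℂ) : Set ℂ :=
  ⋂ n : ℕ, ⋂ _ : 0 < n, cantorDisks p q k c Λ r δ n z

/-- The Cantor bundle `ℬ(Λ) = ⋃_{z ∈ Λ} {z} × 𝒞(z)`; the bundle projection is `Prod.fst`. -/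
def cantorBundle (p q : ℕ) (k : HypKind) (c : ℂ) (Λ : Set ℂ) (r δ : ℝ) : Set (ℂ × ℂ) :=
  {x | x.1 ∈ Λ ∧ x.2 ∈ cantorFiber p q k c Λ r δ x.1}

/-- `z₁` is the first point of the orbit encoded by `x = (z, s)`: the image (resp. pre-image) of
`z` in `Λ` whose disk `r z₁ + δ 𝔻̄` contains `s`. -/
def IsFirstPoint (p q : ℕ) (k : HypKind) (c : ℂ) (Λ : Set ℂ) (r δ : ℝ) (x : ℂ × ℂ) (z₁ : ℂ) :
    Prop :=
  z₁ ∈ Λ ∧ Step p q k c x.1 z₁ ∧ x.2 ∈ closedBall ((r : ℂ) * z₁) δ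

/-- The point `z₁` of the previous definition (it exists for `x ∈ ℬ(Λ)`, and is unique when the
disks are disjoint). -/
def firstPoint (p q : ℕ) (k : HypKind) (c : ℂ) (Λ : Set ℂ) (r δ : ℝ) (x : ℂ × ℂ) : ℂ :=
  Classical.epsilon (IsFirstPoint p q k c Λ r δ x)

theorem firstPoint_eq {p q : ℕ} {k : HypKind} {c : ℂ} {Λ : Set ℂ} {r δ : ℝ} {x : ℂ × ℂ} {z₁ : ℂ}
    (h : IsBundleScale p q c Λ r δ) (hx : x.1 ∈ Λ) (hz : IsFirstPoint p q k c Λ r δ x z₁) :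
    firstPoint p q k c Λ r δ x = z₁ := by
  have hs : IsFirstPoint p q k c Λ r δ x (firstPoint p q k c Λ r δ x) :=
    Classical.epsilon_spec (p := IsFirstPoint p q k c Λ r δ x) ⟨z₁, hz⟩
  by_contra hne
  exact Set.disjoint_left.mp
    (h.disjoint_disks k x.1 hx _ hs.1 _ hz.1 hs.2.1 hz.2.1 hne) hs.2.2 hz.2.2

/-- The bundle map `f_c (z, s) = (z₁, δ⁻¹ s - r δ⁻¹ z₁)` on the Cantor bundle. -/
def bundleMap (p q : ℕ) (k : HypKind) (c : ℂ) (Λ : Set ℂ) (r δ : ℝ) (x : ℂ × ℂ) : ℂ × ℂ :=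
  (firstPoint p q k c Λ r δ x,
    (δ : ℂ)⁻¹ * x.2 - (r : ℂ) * (δ : ℂ)⁻¹ * firstPoint p q k c Λ r δ x)

/-- The identification `Φ` of the Cantor bundle formed with `(r, δ)` with the one formed with
`(r', δ')`: it sends `(z, r ∑ δ^(n-1) z_n)` to `(z, r' ∑ δ'^(n-1) z_n)`. -/
def changeScale (p q : ℕ) (k : HypKind) (c : ℂ) (Λ : Set ℂ) (r δ r' δ' : ℝ) (x : ℂ × ℂ) : ℂ × ℂ :=
  (x.1, (r' : ℂ) * ∑' n : ℕ, (δ' : ℂ) ^ n * ((bundleMap p q k c Λ r δ)^[n + 1] x).1)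

/-- `[S, Λ]` is a solenoidal extension: `S` is a subset of the Cantor bundle which is invariant
under the bundle map and projects onto `Λ`. -/
structure IsSolenoidalExtension (p q : ℕ) (k : HypKind) (c : ℂ) (Λ : Set ℂ) (r δ : ℝ)
    (S : Set (ℂ × ℂ)) : Prop where
  subset : S ⊆ cantorBundle p q k c Λ r δ
  invariant : MapsTo (bundleMap p q k c Λ r δ) S S
  surjective : Prod.fst '' S = Λ

/-! ### Holomorphic motions of the Cantor bundle -/

/-- `h : U × B → ℂ²` is a holomorphic motion based at `c₀`. -/
structure IsHolomorphicMotion (U : Set ℂ) (B : Set (ℂ × ℂ)) (c₀ : ℂ)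
    (h : ℂ → ℂ × ℂ → ℂ × ℂ) : Prop where
  isOpen : IsOpen U
  isConnected : IsConnected U
  base_mem : c₀ ∈ U
  base : ∀ x ∈ B, h c₀ x = x
  injOn : ∀ c ∈ U, InjOn (h c) B
  holomorphic : ∀ x ∈ B, DifferentiableOn ℂ (fun c => h c x) U

/-- `Λ_c = π h_c (ℬ(Λ))`. -/
def movedSet (p q : ℕ) (k : HypKind) (c₀ : ℂ) (Λ : Set ℂ) (r δ : ℝ) (h : ℂ → ℂ × ℂ → ℂ × ℂ)
    (c : ℂ) : Set ℂ :=
  Prod.fst '' (h c '' cantorBundle p q k c₀ Λ r δ)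

/-- `h : U × ℬ(Λ) → ℂ²` is a holomorphic motion based at `c₀`, on a bounded domain `U`, such that
* every `Λ_c` is a hyperbolic set of `𝐟_c`, of the same type as `Λ`, whose Cantor bundle can be
  formed with `(r, δ)`, and it varies continuously in the Hausdorff metric;
* `h_c` maps `ℬ(Λ)` onto a subset of `ℬ(Λ_c)` invariant under the bundle map `f_c`, and
  `h_c ∘ f_{c₀} = f_c ∘ h_c`;
* `h` is Lipschitz in `c`, uniformly in `x`. -/
structure IsBundleMotion (p q : ℕ) (k : HypKind) (c₀ : ℂ) (Λ : Set ℂ) (r δ : ℝ) (U : Set ℂ)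
    (h : ℂ → ℂ × ℂ → ℂ × ℂ) : Prop where
  bounded : Bornology.IsBounded U
  motion : IsHolomorphicMotion U (cantorBundle p q k c₀ Λ r δ) c₀ h
  hyperbolic : ∀ c ∈ U, IsHyperbolicSet p q k c (movedSet p q k c₀ Λ r δ h c)
  scale : ∀ c ∈ U, IsBundleScale p q c (movedSet p q k c₀ Λ r δ h c) r δ
  hausdorff : ∀ c ∈ U, Tendsto
    (fun u => hausdorffDist (movedSet p q k c₀ Λ r δ h u) (movedSet p q k c₀ Λ r δ h c))
    (𝓝[U] c) (𝓝 0)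
  mapsTo : ∀ c ∈ U, MapsTo (h c) (cantorBundle p q k c₀ Λ r δ)
    (cantorBundle p q k c (movedSet p q k c₀ Λ r δ h c) r δ)
  image_invariant : ∀ c ∈ U, MapsTo (bundleMap p q k c (movedSet p q k c₀ Λ r δ h c) r δ)
    (h c '' cantorBundle p q k c₀ Λ r δ) (h c '' cantorBundle p q k c₀ Λ r δ)
  conj : ∀ c ∈ U, ∀ x ∈ cantorBundle p q k c₀ Λ r δ,
    h c (bundleMap p q k c₀ Λ r δ x) =
      bundleMap p q k c (movedSet p q k c₀ Λ r δ h c) r δ (h c x)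
  lipschitz : ∃ C : ℝ, 0 < C ∧ ∀ u ∈ U, ∀ v ∈ U, ∀ x ∈ cantorBundle p q k c₀ Λ r δ,
    ‖h u x - h v x‖ ≤ C * ‖u - v‖

/-- The multifunction `𝐡(c, z) = π ∘ h_c ∘ (π|_S)⁻¹ (z)`. -/
def inducedMulti (S : Set (ℂ × ℂ)) (h : ℂ → ℂ × ℂ → ℂ × ℂ) (c z : ℂ) : Set ℂ :=
  {w | ∃ x ∈ S, x.1 = z ∧ (h c x).1 = w}

/-! ### Branched holomorphic motions -/

/-- Normal families on `U` (Montel): every sequence has a subsequence that converges locally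
uniformly on `U`. -/
def IsNormalFamily (U : Set ℂ) (F : Set (ℂ → ℂ)) : Prop :=
  ∀ f : ℕ → ℂ → ℂ, (∀ n, f n ∈ F) → ∃ (φ : ℕ → ℕ) (g : ℂ → ℂ), StrictMono φ ∧
    TendstoLocallyUniformlyOn (fun n => f (φ n)) g atTop U

/-- `H : U × A → ℂ` is a normal branched holomorphic motion with base point `c₀`: it is a
multifunction (nonempty values) with `H_{c₀}(z) = {z}`, and the union over `z ∈ A` of the sets
`⋃_{c ∈ U} {c} × H_c(z)` is the union of the graphs of a normal family of holomorphic functions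
`U → ℂ`. (Since these functions are finite-valued, so is `H`, and the point at infinity plays no
role.) -/
structure IsNormalBranchedMotion (U A : Set ℂ) (c₀ : ℂ) (H : ℂ → ℂ → Set ℂ) : Prop where
  isOpen : IsOpen U
  isConnected : IsConnected U
  base_mem : c₀ ∈ U
  nonempty : ∀ c ∈ U, ∀ z ∈ A, (H c z).Nonempty
  base : ∀ z ∈ A, H c₀ z = {z}
  graphs : ∃ F : Set (ℂ → ℂ), (∀ f ∈ F, DifferentiableOn ℂ f U) ∧
    (⋃ z ∈ A, {y : ℂ × ℂ | y.1 ∈ U ∧ y.2 ∈ H y.1 z}) = (⋃ f ∈ F, U.graphOn f) ∧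
    IsNormalFamily U F

end PowerCorr

end

/-! A point `(z, s)` of the Cantor bundle is an infinite orbit `z, z₁, z₂, …` in disguise: `s = r ∑
δ^(n-1) z_n`, and the bundle map becomes the shift (`IsBundleScale.decode_encode`,
`IsBundleScale.encode_decode`, `IsBundleScale.bundleMap_encode`). So an admissible scale is only a
coordinate on the space of orbits, and `Φ` decodes in one coordinate and encodes in another. Bundle
motions translate into motions of orbits, `IsOrbitMotion`, where no scale occurs, and back at every
scale that stays admissible (`IsBundleMotion.isOrbitMotion`, `IsOrbitMotion.isBundleMotion`).

For orbits the theorem is a shadowing statement. One step backwards along an orbit is an inverse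
branch of `𝐟_c` in the expanding case and a branch of `𝐟_c` in the attracting case. In the
hyperbolic metric both contract, up to an error linear in the change of `c`
(`IsHyperbolicSet.exists_isContracting`). Repeated pulling back therefore converges: each orbit of
`Λ` is shadowed by exactly one orbit of the perturbed correspondence, a uniform limit of holomorphic
functions of `c`, with a Lipschitz bound (`IsContracting.exists_shadow`,
`IsContracting.shadow_unique`, `IsContracting.dist_shadows_le`). Since hyperbolicity and
admissibility are open conditions, the shadows form a motion
(`IsHyperbolicSet.exists_isOrbitMotion`).

Conversely, near any parameter `c₁` a motion consists of shadows of the orbits in the hyperbolic set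
`Λ_{c₁}`. Agreement of two motions is thus an open condition on the parameter; disagreement is open
by continuity, and connectedness concludes (`IsOrbitMotion.unique`). Uniqueness and independence of
the scale follow together. Normality is Arzelà–Ascoli: the moved points are uniformly bounded and
uniformly Lipschitz in `c`. -/

namespace PowerCorr

/-! ### Orbits and their codes -/

/-- The infinite orbits in `Λ`, in the direction given by `k`. -/
def orbits (p q : ℕ) (k : HypKind) (c : ℂ) (Λ : Set ℂ) : Set (ℕ → ℂ) :=
  {x | (∀ i, x i ∈ Λ) ∧ ∀ i, Step p q k c (x i) (x (i + 1))}

/-- The `n`-th shift of a sequence. -/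
def tail (n : ℕ) (x : ℕ → ℂ) : ℕ → ℂ := fun i => x (i + n)

/-- The point of the Cantor bundle that encodes the orbit `x`. -/
noncomputable def encode (r δ : ℝ) (x : ℕ → ℂ) : ℂ × ℂ :=
  (x 0, (r : ℂ) * ∑' n : ℕ, (δ : ℂ) ^ n * x (n + 1))

/-- The orbit encoded by a point of the Cantor bundle. -/
noncomputable def decode (p q : ℕ) (k : HypKind) (c : ℂ) (Λ : Set ℂ) (r δ : ℝ) (y : ℂ × ℂ) :
    ℕ → ℂ :=
  fun n => ((bundleMap p q k c Λ r δ)^[n] y).1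

@[simp] theorem tail_apply (n : ℕ) (x : ℕ → ℂ) (i : ℕ) : tail n x i = x (i + n) := rfl

@[simp] theorem tail_zero (x : ℕ → ℂ) : tail 0 x = x := rfl

theorem tail_tail (m n : ℕ) (x : ℕ → ℂ) : tail m (tail n x) = tail (m + n) x := by
  funext i
  simp [add_assoc]

@[simp] theorem encode_fst (r δ : ℝ) (x : ℕ → ℂ) : (encode r δ x).1 = x 0 := rfl

variable {p q : ℕ} {k : HypKind} {c : ℂ} {Λ : Set ℂ} {r δ : ℝ}

theorem tail_mem_orbits {x : ℕ → ℂ} (hx : x ∈ orbits p q k c Λ) (n : ℕ) :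
    tail n x ∈ orbits p q k c Λ := by
  refine ⟨fun i => hx.1 _, fun i => ?_⟩
  have := hx.2 (i + n)
  rwa [add_right_comm] at this

theorem mem_orbits_of_isOrbitFrom {z : ℂ} {x : ℕ → ℂ} (hx : IsOrbitFrom p q k c Λ z x) :
    x ∈ orbits p q k c Λ := hx.2

theorem exists_orbit (hΛ : IsSemiInvariant p q c Λ) (k : HypKind) {z : ℂ} (hz : z ∈ Λ) :
    ∃ x ∈ orbits p q k c Λ, x 0 = z := by
  have hstep : ∀ z : Λ, ∃ w : Λ, Step p q k c z w := by
    rintro ⟨z, hz⟩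
    cases k with
    | expanding => obtain ⟨w, hw, h⟩ := hΛ.image z hz; exact ⟨⟨w, hw⟩, h⟩
    | attracting => obtain ⟨w, hw, h⟩ := hΛ.preimage z hz; exact ⟨⟨w, hw⟩, h⟩
  choose f hf using hstep
  refine ⟨fun n => (f^[n] ⟨z, hz⟩ : Λ), ⟨fun i => Subtype.coe_prop _, fun i => ?_⟩, rfl⟩
  simp only [Function.iterate_succ_apply']
  exact hf _

theorem exists_step_from (hΛ : IsSemiInvariant p q c Λ) (k : HypKind) {z : ℂ} (hz : z ∈ Λ) :
    ∃ y ∈ Λ, Step p q k c y z := by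
  cases k with
  | expanding => exact hΛ.preimage z hz
  | attracting => exact hΛ.image z hz

/-- The point of the closed disk about `r w` farthest from the origin is `(r + δ / ‖w‖) w`, and it
must lie in the open unit disk. The annulus condition ensures `w ≠ 0`. -/
theorem IsBundleScale.norm_step (h : IsBundleScale p q c Λ r δ) {z w : ℂ}
    (hz : z ∈ Λ) (hw : w ∈ Λ) (hs : Step p q k c z w) : r * ‖w‖ + δ < 1 := by
  have h1 := h.disks_subset k z hz w hw hs
  have hδ := h.δ_pos
  have hr := h.r_pos
  have hw0 : 0 < ‖w‖ := hr.trans (h.subset_annulus w hw).1.1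
  have hmem : (r : ℂ) * w + (δ / ‖w‖ : ℝ) * w ∈ closedBall ((r : ℂ) * w) δ := by
    rw [mem_closedBall, dist_eq_norm, add_sub_cancel_left, norm_mul, Complex.norm_real,
      Real.norm_of_nonneg (by positivity), div_mul_cancel₀ _ hw0.ne']
  have h2 := h1 hmem
  rw [mem_ball_zero_iff, ← add_mul, ← Complex.ofReal_add, norm_mul, Complex.norm_real,
    Real.norm_of_nonneg (by positivity), add_mul, div_mul_cancel₀ _ hw0.ne'] at h2
  exact h2

theorem IsBundleScale.norm_orbit (h : IsBundleScale p q c Λ r δ) {x : ℕ → ℂ}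
    (hx : x ∈ orbits p q k c Λ) (i : ℕ) : r * ‖x (i + 1)‖ ≤ 1 - δ := by
  have := h.norm_step (hx.1 i) (hx.1 (i + 1)) (hx.2 i)
  linarith

theorem IsBundleScale.δ_lt_one (h : IsBundleScale p q c Λ r δ) {x : ℕ → ℂ}
    (hx : x ∈ orbits p q k c Λ) : δ < 1 := by
  have := h.norm_step (hx.1 0) (hx.1 1) (hx.2 0)
  nlinarith [norm_nonneg (x 1), h.r_pos]

theorem summable_code {x : ℕ → ℂ} {R : ℝ} (hδ : 0 ≤ δ) (hδ1 : δ < 1) (hx : ∀ i, ‖x i‖ ≤ R) :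
    Summable fun n : ℕ => (δ : ℂ) ^ n * x (n + 1) := by
  refine Summable.of_norm_bounded ((summable_geometric_of_lt_one hδ hδ1).mul_right R) fun n => ?_
  rw [norm_mul, norm_pow, Complex.norm_real, Real.norm_of_nonneg hδ]
  gcongr
  exact hx _

theorem IsBundleScale.norm_le (h : IsBundleScale p q c Λ r δ) {z : ℂ} (hz : z ∈ Λ) :
    ‖z‖ ≤ 1 / (2 * r) := (h.subset_annulus z hz).1.2.le

theorem IsBundleScale.summable (h : IsBundleScale p q c Λ r δ) {x : ℕ → ℂ}
    (hx : x ∈ orbits p q k c Λ) : Summable fun n : ℕ => (δ : ℂ) ^ n * x (n + 1) :=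
  summable_code h.δ_pos.le (h.δ_lt_one hx) fun i => h.norm_le (hx.1 i)

/-- The `n`-th term has norm at most `δ ^ n * (1 - δ) = δ ^ n - δ ^ (n + 1)`, so the bounds
telescope. This precise form is what makes the disks along one orbit nested. -/
theorem IsBundleScale.norm_partial_sum_le (h : IsBundleScale p q c Λ r δ) {x : ℕ → ℂ}
    (hx : x ∈ orbits p q k c Λ) (n : ℕ) :
    ‖(r : ℂ) * ∑ i ∈ Finset.range n, (δ : ℂ) ^ i * x (i + 1)‖ ≤ 1 - δ ^ n := by
  have hδ := h.δ_pos
  have hr := h.r_pos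
  induction n with
  | zero => simp
  | succ n ih =>
    rw [Finset.sum_range_succ, mul_add]
    refine (norm_add_le _ _).trans ?_
    have : ‖(r : ℂ) * ((δ : ℂ) ^ n * x (n + 1))‖ ≤ δ ^ n * (1 - δ) := by
      rw [norm_mul, norm_mul, norm_pow, Complex.norm_real, Complex.norm_real,
        Real.norm_of_nonneg hδ.le, Real.norm_of_nonneg hr.le, mul_left_comm]
      gcongr
      exact h.norm_orbit hx n
    rw [pow_succ]
    linarith

theorem IsBundleScale.norm_code_le (h : IsBundleScale p q c Λ r δ) {x : ℕ → ℂ}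
    (hx : x ∈ orbits p q k c Λ) : ‖(encode r δ x).2‖ ≤ 1 := by
  have hlim : Tendsto (fun n => ‖(r : ℂ) * ∑ i ∈ Finset.range n, (δ : ℂ) ^ i * x (i + 1)‖) atTop
      (𝓝 ‖(encode r δ x).2‖) :=
    ((h.summable hx).hasSum.tendsto_sum_nat.const_mul (r : ℂ)).norm
  refine le_of_tendsto' hlim fun n => (h.norm_partial_sum_le hx n).trans ?_
  have : 0 ≤ δ ^ n := pow_nonneg h.δ_pos.le n
  linarith

theorem IsBundleScale.encode_eq (h : IsBundleScale p q c Λ r δ) {x : ℕ → ℂ}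
    (hx : x ∈ orbits p q k c Λ) (n : ℕ) :
    (encode r δ x).2 = (r : ℂ) * ∑ i ∈ Finset.range n, (δ : ℂ) ^ i * x (i + 1) +
      (δ : ℂ) ^ n * (encode r δ (tail n x)).2 := by
  simp only [encode, tail_apply]
  have h1 : ∑' i : ℕ, (δ : ℂ) ^ (i + n) * x (i + n + 1) =
      (δ : ℂ) ^ n * ∑' i : ℕ, (δ : ℂ) ^ i * x (i + 1 + n) := by
    rw [← tsum_mul_left]
    refine tsum_congr fun i => ?_
    rw [pow_add, add_right_comm i n 1]
    ring
  rw [← (h.summable hx).sum_add_tsum_nat_add n, h1]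
  ring

theorem IsBundleScale.encode_mem (h : IsBundleScale p q c Λ r δ) {x : ℕ → ℂ}
    (hx : x ∈ orbits p q k c Λ) : encode r δ x ∈ cantorBundle p q k c Λ r δ := by
  refine ⟨hx.1 0, mem_iInter₂.2 fun n _ => ⟨x, ⟨rfl, hx.1, hx.2⟩, ?_⟩⟩
  rw [mem_closedBall, dist_eq_norm, h.encode_eq hx n, add_sub_cancel_left, norm_mul, norm_pow,
    Complex.norm_real, Real.norm_of_nonneg h.δ_pos.le]
  exact mul_le_of_le_one_right (pow_nonneg h.δ_pos.le n) (h.norm_code_le (tail_mem_orbits hx n))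

/-- A disk of level `n + 1` lies inside the level-one disk of the same orbit, because `δ ^ (n + 1) +
δ * (1 - δ ^ n) = δ`. Hence membership at any level already determines the first point. -/
theorem IsBundleScale.isFirstPoint (h : IsBundleScale p q c Λ r δ) {x : ℕ → ℂ} {s : ℂ} {n : ℕ}
    (hx : x ∈ orbits p q k c Λ)
    (hs : s ∈ closedBall ((r : ℂ) * ∑ i ∈ Finset.range (n + 1), (δ : ℂ) ^ i * x (i + 1))
      (δ ^ (n + 1))) :
    IsFirstPoint p q k c Λ r δ (x 0, s) (x 1) := by
  refine ⟨hx.1 1, hx.2 0, ?_⟩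
  have h1 := h.norm_partial_sum_le (tail_mem_orbits hx 1) n
  rw [mem_closedBall, dist_eq_norm] at hs ⊢
  rw [Finset.sum_range_succ'] at hs
  have h2 : (∑ i ∈ Finset.range n, (δ : ℂ) ^ (i + 1) * x (i + 1 + 1)) =
      δ * ∑ i ∈ Finset.range n, (δ : ℂ) ^ i * tail 1 x (i + 1) := by
    rw [Finset.mul_sum]
    exact Finset.sum_congr rfl fun i _ => by rw [tail_apply]; ring
  rw [h2] at hs
  set T := ∑ i ∈ Finset.range n, (δ : ℂ) ^ i * tail 1 x (i + 1)
  have h3 : s - r * x 1 = (s - r * (δ * T + (δ : ℂ) ^ 0 * x (0 + 1))) + δ * (r * T) := by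
    simp only [pow_zero, zero_add]
    ring
  have h4 : ‖(δ : ℂ) * (r * T)‖ ≤ δ * (1 - δ ^ n) := by
    rw [norm_mul, Complex.norm_real, Real.norm_of_nonneg h.δ_pos.le]
    exact mul_le_mul_of_nonneg_left h1 h.δ_pos.le
  calc ‖s - r * x 1‖ ≤ δ ^ (n + 1) + δ * (1 - δ ^ n) := by
        rw [h3]; exact (norm_add_le _ _).trans (add_le_add hs h4)
    _ = δ := by ring

theorem IsBundleScale.firstPoint_encode (h : IsBundleScale p q c Λ r δ) {x : ℕ → ℂ}
    (hx : x ∈ orbits p q k c Λ) : firstPoint p q k c Λ r δ (encode r δ x) = x 1 := by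
  refine firstPoint_eq h (hx.1 0) (h.isFirstPoint (n := 0) hx ?_)
  change (encode r δ x).2 ∈ _
  rw [mem_closedBall, dist_eq_norm, h.encode_eq hx 1, zero_add, add_sub_cancel_left, norm_mul,
    norm_pow, Complex.norm_real, Real.norm_of_nonneg h.δ_pos.le]
  exact mul_le_of_le_one_right (pow_nonneg h.δ_pos.le _) (h.norm_code_le (tail_mem_orbits hx 1))

theorem IsBundleScale.bundleMap_encode (h : IsBundleScale p q c Λ r δ) {x : ℕ → ℂ}
    (hx : x ∈ orbits p q k c Λ) :
    bundleMap p q k c Λ r δ (encode r δ x) = encode r δ (tail 1 x) := by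
  have hδ : (δ : ℂ) ≠ 0 := by exact_mod_cast h.δ_pos.ne'
  refine Prod.ext (h.firstPoint_encode hx) ?_
  simp only [bundleMap]
  rw [h.firstPoint_encode hx, h.encode_eq hx 1]
  simp only [Finset.sum_range_one, pow_zero, one_mul, pow_one, zero_add]
  field_simp
  ring

theorem IsBundleScale.iterate_bundleMap_encode (h : IsBundleScale p q c Λ r δ) {x : ℕ → ℂ}
    (hx : x ∈ orbits p q k c Λ) (n : ℕ) :
    (bundleMap p q k c Λ r δ)^[n] (encode r δ x) = encode r δ (tail n x) := by
  induction n with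
  | zero => rfl
  | succ n ih =>
    rw [Function.iterate_succ_apply', ih, h.bundleMap_encode (tail_mem_orbits hx n), tail_tail,
      add_comm]

theorem IsBundleScale.decode_encode (h : IsBundleScale p q c Λ r δ) {x : ℕ → ℂ}
    (hx : x ∈ orbits p q k c Λ) : decode p q k c Λ r δ (encode r δ x) = x := by
  funext n
  simp [decode, h.iterate_bundleMap_encode hx n]

/-- The orbit witnessing membership in `𝒟_n` may change with `n`, but disjointness of the disks
forces all of these orbits through the same first point. After removing it, a witness for level `n +
1` becomes a witness for level `n` at the image. -/
theorem IsBundleScale.bundleMap_mem (h : IsBundleScale p q c Λ r δ) {y : ℂ × ℂ}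
    (hy : y ∈ cantorBundle p q k c Λ r δ) :
    Step p q k c y.1 (bundleMap p q k c Λ r δ y).1 ∧
      bundleMap p q k c Λ r δ y ∈ cantorBundle p q k c Λ r δ := by
  obtain ⟨z, s⟩ := y
  have hδ := h.δ_pos
  have hδ0 : (δ : ℂ) ≠ 0 := by exact_mod_cast hδ.ne'
  have key : ∀ n, ∃ x ∈ orbits p q k c Λ, x 0 = z ∧ firstPoint p q k c Λ r δ (z, s) = x 1 ∧
      s ∈ closedBall ((r : ℂ) * ∑ i ∈ Finset.range (n + 1), (δ : ℂ) ^ i * x (i + 1))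
        (δ ^ (n + 1)) := by
    intro n
    obtain ⟨x, hx, hs⟩ := mem_iInter₂.1 hy.2 (n + 1) n.succ_pos
    refine ⟨x, hx.2, hx.1, ?_, hs⟩
    have h1 := h.isFirstPoint (mem_orbits_of_isOrbitFrom hx) hs
    rw [hx.1] at h1
    exact firstPoint_eq h hy.1 h1
  obtain ⟨x, hx, hx0, hx1, -⟩ := key 0
  refine ⟨?_, ?_, mem_iInter₂.2 fun n hn => ?_⟩
  · simp only [bundleMap]
    rw [hx1, ← hx0]
    exact hx.2 0
  · simp only [bundleMap]
    rw [hx1]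
    exact hx.1 1
  · obtain ⟨x, hx, hx0, hx1, hs⟩ := key n
    refine ⟨tail 1 x, ⟨?_, (tail_mem_orbits hx 1).1, (tail_mem_orbits hx 1).2⟩, ?_⟩
    · simp only [bundleMap]
      rw [hx1, tail_apply]
    · simp only [bundleMap]
      rw [hx1]
      rw [mem_closedBall, dist_eq_norm] at hs ⊢
      have h2 : s - r * ∑ i ∈ Finset.range (n + 1), (δ : ℂ) ^ i * x (i + 1) =
          δ * ((δ : ℂ)⁻¹ * s - r * (δ : ℂ)⁻¹ * x 1 -
            r * ∑ i ∈ Finset.range n, (δ : ℂ) ^ i * tail 1 x (i + 1)) := by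
        rw [Finset.sum_range_succ']
        have h3 : (∑ i ∈ Finset.range n, (δ : ℂ) ^ (i + 1) * x (i + 1 + 1)) =
            δ * ∑ i ∈ Finset.range n, (δ : ℂ) ^ i * tail 1 x (i + 1) := by
          rw [Finset.mul_sum]
          exact Finset.sum_congr rfl fun i _ => by rw [tail_apply]; ring
        rw [h3]
        simp only [pow_zero, one_mul, zero_add]
        field_simp
        ring
      rw [h2, norm_mul, Complex.norm_real, Real.norm_of_nonneg hδ.le, pow_succ'] at hs
      exact le_of_mul_le_mul_left hs hδ

theorem IsBundleScale.norm_snd_le (h : IsBundleScale p q c Λ r δ) {y : ℂ × ℂ}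
    (hy : y ∈ cantorBundle p q k c Λ r δ) : ‖y.2‖ ≤ 1 := by
  obtain ⟨x, hx, hs⟩ := mem_iInter₂.1 hy.2 1 one_pos
  have h1 := h.disks_subset k (x 0) (hx.2.1 0) (x 1) (hx.2.1 1) (hx.2.2 0)
  simp only [Finset.sum_range_one, pow_zero, one_mul, pow_one, zero_add] at hs
  exact (mem_ball_zero_iff.1 (h1 hs)).le

theorem IsBundleScale.iterate_mem (h : IsBundleScale p q c Λ r δ) {y : ℂ × ℂ}
    (hy : y ∈ cantorBundle p q k c Λ r δ) (n : ℕ) :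
    (bundleMap p q k c Λ r δ)^[n] y ∈ cantorBundle p q k c Λ r δ := by
  induction n with
  | zero => exact hy
  | succ n ih => rw [Function.iterate_succ_apply']; exact (h.bundleMap_mem ih).2

theorem IsBundleScale.decode_mem (h : IsBundleScale p q c Λ r δ) {y : ℂ × ℂ}
    (hy : y ∈ cantorBundle p q k c Λ r δ) : decode p q k c Λ r δ y ∈ orbits p q k c Λ := by
  refine ⟨fun i => (h.iterate_mem hy i).1, fun i => ?_⟩
  have := (h.bundleMap_mem (h.iterate_mem hy i)).1
  simp only [decode]
  rwa [Function.iterate_succ_apply']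

/-- Unrolling the bundle map `n` times writes `y.2` as a partial sum of the code plus `δ ^ n` times
the second coordinate of the `n`-th iterate. The latter is bounded by `1`, so the remainder tends to
zero. -/
theorem IsBundleScale.encode_decode (h : IsBundleScale p q c Λ r δ) {y : ℂ × ℂ}
    (hy : y ∈ cantorBundle p q k c Λ r δ) : encode r δ (decode p q k c Λ r δ y) = y := by
  set f := bundleMap p q k c Λ r δ with hf
  have hδ0 : (δ : ℂ) ≠ 0 := by exact_mod_cast h.δ_pos.ne'
  have hd := h.decode_mem hy
  refine Prod.ext rfl ?_
  have hsum : ∀ n, y.2 = (r : ℂ) * ∑ i ∈ Finset.range n, (δ : ℂ) ^ i *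
      decode p q k c Λ r δ y (i + 1) + (δ : ℂ) ^ n * (f^[n] y).2 := by
    intro n
    induction n with
    | zero => simp
    | succ n ih =>
      have h1 : (f^[n + 1] y).2 = (δ : ℂ)⁻¹ * (f^[n] y).2 - r * (δ : ℂ)⁻¹ * (f^[n + 1] y).1 := by
        rw [Function.iterate_succ_apply']
        rfl
      have h2 : decode p q k c Λ r δ y (n + 1) = (f^[n + 1] y).1 := rfl
      rw [Finset.sum_range_succ, h2, h1, ih]
      field_simp
      ring
  have hlim1 : Tendsto (fun n => (r : ℂ) * ∑ i ∈ Finset.range n, (δ : ℂ) ^ i *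
      decode p q k c Λ r δ y (i + 1)) atTop (𝓝 (encode r δ (decode p q k c Λ r δ y)).2) :=
    (h.summable hd).hasSum.tendsto_sum_nat.const_mul (r : ℂ)
  have hlim2 : Tendsto (fun n => (δ : ℂ) ^ n * (f^[n] y).2) atTop (𝓝 0) := by
    refine squeeze_zero_norm (fun n => ?_)
      (tendsto_pow_atTop_nhds_zero_of_lt_one h.δ_pos.le (h.δ_lt_one hd))
    rw [norm_mul, norm_pow, Complex.norm_real, Real.norm_of_nonneg h.δ_pos.le]
    exact mul_le_of_le_one_right (pow_nonneg h.δ_pos.le n) (h.norm_snd_le (h.iterate_mem hy n))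
  have hlim := hlim1.add hlim2
  simp_rw [← hsum, add_zero] at hlim
  exact tendsto_nhds_unique hlim tendsto_const_nhds

theorem IsBundleScale.cantorBundle_eq (h : IsBundleScale p q c Λ r δ) :
    cantorBundle p q k c Λ r δ = encode r δ '' orbits p q k c Λ :=
  Subset.antisymm (fun _ hy => ⟨_, h.decode_mem hy, h.encode_decode hy⟩)
    (image_subset_iff.2 fun _ hx => h.encode_mem hx)

theorem changeScale_eq (r' δ' : ℝ) (y : ℂ × ℂ) :
    changeScale p q k c Λ r δ r' δ' y = encode r' δ' (decode p q k c Λ r δ y) := rfl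

end PowerCorr

namespace PowerCorr

/-! ### Motions of the orbits in a hyperbolic set -/

/-- The sequence traced by the moved orbit, when `w c x` is the position at time `c` of the first
point of the orbit `x`. -/
def trace (w : ℂ → (ℕ → ℂ) → ℂ) (c : ℂ) (x : ℕ → ℂ) : ℕ → ℂ := fun n => w c (tail n x)

theorem tail_trace (w : ℂ → (ℕ → ℂ) → ℂ) (c : ℂ) (x : ℕ → ℂ) (m : ℕ) :
    tail m (trace w c x) = trace w c (tail m x) := by
  funext n
  simp [trace, tail_tail]

/-- A motion of the orbits in `Λ`: the point `w c x` is the position at time `c` of the first point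
of the orbit `x`. This is a bundle motion without reference to the scale of the bundle. -/
structure IsOrbitMotion (p q : ℕ) (k : HypKind) (c₀ : ℂ) (Λ : Set ℂ) (U : Set ℂ)
    (w : ℂ → (ℕ → ℂ) → ℂ) : Prop where
  bounded : Bornology.IsBounded U
  isOpen : IsOpen U
  isConnected : IsConnected U
  base_mem : c₀ ∈ U
  base : ∀ x ∈ orbits p q k c₀ Λ, w c₀ x = x 0
  step : ∀ c ∈ U, ∀ x ∈ orbits p q k c₀ Λ, Step p q k c (w c x) (w c (tail 1 x))
  injOn : ∀ c ∈ U, InjOn (trace w c) (orbits p q k c₀ Λ)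
  holomorphic : ∀ x ∈ orbits p q k c₀ Λ, DifferentiableOn ℂ (fun c => w c x) U
  hyperbolic : ∀ c ∈ U, IsHyperbolicSet p q k c (w c '' orbits p q k c₀ Λ)
  lipschitz : ∃ C : ℝ, 0 < C ∧ ∀ u ∈ U, ∀ v ∈ U, ∀ x ∈ orbits p q k c₀ Λ,
    ‖w u x - w v x‖ ≤ C * ‖u - v‖

/-- The motion of the Cantor bundle given by a motion of orbits. -/
noncomputable def bundleLift (p q : ℕ) (k : HypKind) (c₀ : ℂ) (Λ : Set ℂ) (r δ : ℝ)
    (w : ℂ → (ℕ → ℂ) → ℂ) (c : ℂ) (y : ℂ × ℂ) : ℂ × ℂ :=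
  encode r δ (trace w c (decode p q k c₀ Λ r δ y))

variable {p q : ℕ} {k : HypKind} {c₀ c : ℂ} {Λ U : Set ℂ} {r δ : ℝ} {w : ℂ → (ℕ → ℂ) → ℂ}

/-- The geometric series sums the termwise differences; `R` serves only for summability and does not
enter the constant. This carries the Lipschitz bound from orbits to codes. -/
theorem norm_encode_sub_le {x y : ℕ → ℂ} {R D : ℝ} (hr : 0 ≤ r) (hδ : 0 ≤ δ) (hδ1 : δ < 1)
    (hx : ∀ i, ‖x i‖ ≤ R) (hy : ∀ i, ‖y i‖ ≤ R) (hD : ∀ i, ‖x i - y i‖ ≤ D) :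
    ‖encode r δ x - encode r δ y‖ ≤ (1 + r / (1 - δ)) * D := by
  have hD0 : 0 ≤ D := (norm_nonneg _).trans (hD 0)
  have h1 : 0 < 1 - δ := by linarith
  have h0 : 0 ≤ r / (1 - δ) := by positivity
  refine (norm_prod_le_iff).2 ⟨?_, ?_⟩
  · refine (hD 0).trans ?_
    nlinarith
  · have h2 : (encode r δ x - encode r δ y).2 =
        r * ∑' n : ℕ, (δ : ℂ) ^ n * (x (n + 1) - y (n + 1)) := by
      simp only [encode, Prod.snd_sub, mul_sub]
      rw [(summable_code hδ hδ1 hx).tsum_sub (summable_code hδ hδ1 hy), mul_sub]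
    have h3 : ‖∑' n : ℕ, (δ : ℂ) ^ n * (x (n + 1) - y (n + 1))‖ ≤ (1 - δ)⁻¹ * D := by
      refine tsum_of_norm_bounded ((hasSum_geometric_of_lt_one hδ hδ1).mul_right D) fun n => ?_
      rw [norm_mul, norm_pow, Complex.norm_real, Real.norm_of_nonneg hδ]
      gcongr
      exact hD _
    rw [h2, norm_mul, Complex.norm_real, Real.norm_of_nonneg hr]
    calc r * ‖∑' n : ℕ, (δ : ℂ) ^ n * (x (n + 1) - y (n + 1))‖ ≤ r * ((1 - δ)⁻¹ * D) := by gcongr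
      _ = r / (1 - δ) * D := by ring
      _ ≤ (1 + r / (1 - δ)) * D := by nlinarith

theorem IsOrbitMotion.trace_mem (hw : IsOrbitMotion p q k c₀ Λ U w) (hc : c ∈ U) {x : ℕ → ℂ}
    (hx : x ∈ orbits p q k c₀ Λ) :
    trace w c x ∈ orbits p q k c (w c '' orbits p q k c₀ Λ) := by
  refine ⟨fun i => ⟨_, tail_mem_orbits hx i, rfl⟩, fun i => ?_⟩
  have := hw.step c hc _ (tail_mem_orbits hx i)
  rwa [tail_tail, add_comm] at this

theorem IsOrbitMotion.trace_base (hw : IsOrbitMotion p q k c₀ Λ U w) {x : ℕ → ℂ}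
    (hx : x ∈ orbits p q k c₀ Λ) : trace w c₀ x = x := by
  funext n
  simp [trace, hw.base _ (tail_mem_orbits hx n)]

theorem bundleLift_encode (h : IsBundleScale p q c₀ Λ r δ) {x : ℕ → ℂ}
    (hx : x ∈ orbits p q k c₀ Λ) (c : ℂ) :
    bundleLift p q k c₀ Λ r δ w c (encode r δ x) = encode r δ (trace w c x) := by
  rw [bundleLift, h.decode_encode hx]

theorem movedSet_bundleLift (h : IsBundleScale p q c₀ Λ r δ) (w : ℂ → (ℕ → ℂ) → ℂ) (c : ℂ) :
    movedSet p q k c₀ Λ r δ (bundleLift p q k c₀ Λ r δ w) c = w c '' orbits p q k c₀ Λ := by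
  rw [movedSet, h.cantorBundle_eq, image_image, image_image]
  refine image_congr fun x hx => ?_
  rw [bundleLift_encode h hx]
  rfl

theorem hausdorffDist_image_le {s : Set (ℕ → ℂ)} {C : ℝ} {u v : ℂ} (hC : 0 ≤ C)
    (h : ∀ x ∈ s, ‖w u x - w v x‖ ≤ C * ‖u - v‖) :
    hausdorffDist (w u '' s) (w v '' s) ≤ C * ‖u - v‖ := by
  refine hausdorffDist_le_of_mem_dist (by positivity) ?_ ?_
  · rintro _ ⟨x, hx, rfl⟩
    exact ⟨_, mem_image_of_mem _ hx, by rw [dist_eq_norm]; exact h x hx⟩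
  · rintro _ ⟨x, hx, rfl⟩
    exact ⟨_, mem_image_of_mem _ hx, by rw [dist_comm, dist_eq_norm]; exact h x hx⟩

/-- A motion of orbits gives a bundle motion at every admissible scale. -/
theorem IsOrbitMotion.isBundleMotion (hw : IsOrbitMotion p q k c₀ Λ U w)
    (hΛ : IsSemiInvariant p q c₀ Λ) (h : IsBundleScale p q c₀ Λ r δ)
    (hs : ∀ c ∈ U, IsBundleScale p q c (w c '' orbits p q k c₀ Λ) r δ) :
    IsBundleMotion p q k c₀ Λ r δ U (bundleLift p q k c₀ Λ r δ w) := by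
  have hδ1 : δ < 1 := by
    obtain ⟨x, hx, -⟩ := exists_orbit hΛ k hΛ.nonempty.some_mem
    exact h.δ_lt_one hx
  have hR : ∀ c ∈ U, ∀ x ∈ orbits p q k c₀ Λ, ‖w c x‖ ≤ 1 / (2 * r) := fun c hc x hx =>
    (hs c hc).norm_le (mem_image_of_mem _ hx)
  have hconj : ∀ c ∈ U, ∀ x ∈ orbits p q k c₀ Λ,
      bundleMap p q k c (w c '' orbits p q k c₀ Λ) r δ (encode r δ (trace w c x)) =
        encode r δ (trace w c (tail 1 x)) := fun c hc x hx => by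
    rw [(hs c hc).bundleMap_encode (hw.trace_mem hc hx), tail_trace]
  refine ⟨hw.bounded, ⟨hw.isOpen, hw.isConnected, hw.base_mem, ?_, ?_, ?_⟩, ?_, ?_, ?_, ?_, ?_, ?_,
    ?_⟩
  · intro y hy
    rw [bundleLift, hw.trace_base (h.decode_mem hy), h.encode_decode hy]
  · intro c hc y hy y' hy' he
    have h1 := congrArg (decode p q k c (w c '' orbits p q k c₀ Λ) r δ) he
    simp only [bundleLift] at h1
    rw [(hs c hc).decode_encode (hw.trace_mem hc (h.decode_mem hy)),
      (hs c hc).decode_encode (hw.trace_mem hc (h.decode_mem hy'))] at h1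
    rw [← h.encode_decode hy, hw.injOn c hc (h.decode_mem hy) (h.decode_mem hy') h1,
      h.encode_decode hy']
  · intro y hy
    have hx := h.decode_mem hy
    refine (hw.holomorphic _ hx).prodMk (DifferentiableOn.const_mul ?_ _)
    -- The second coordinate is a series of holomorphic functions; the annulus bound on every moved
    -- set gives a convergent majorant independent of `c`.
    refine Complex.differentiableOn_tsum_of_summable_norm (u := fun n => δ ^ n * (1 / (2 * r)))
      ((summable_geometric_of_lt_one h.δ_pos.le hδ1).mul_right _) (fun i => ?_) hw.isOpen ?_
    · exact (hw.holomorphic _ (tail_mem_orbits hx _)).const_mul _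
    · intro n c hc
      rw [norm_mul, norm_pow, Complex.norm_real, Real.norm_of_nonneg h.δ_pos.le]
      exact mul_le_mul_of_nonneg_left (hR c hc _ (tail_mem_orbits hx _))
        (pow_nonneg h.δ_pos.le _)
  · intro c hc
    rw [movedSet_bundleLift h]
    exact hw.hyperbolic c hc
  · intro c hc
    rw [movedSet_bundleLift h]
    exact hs c hc
  · intro c hc
    obtain ⟨C, hC, hL⟩ := hw.lipschitz
    simp only [movedSet_bundleLift h]
    refine squeeze_zero' (Eventually.of_forall fun u => hausdorffDist_nonneg)
      (g := fun u => C * ‖u - c‖) ?_ ?_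
    · filter_upwards [self_mem_nhdsWithin] with u hu
      exact hausdorffDist_image_le hC.le (hL u hu c hc)
    · have : Continuous fun u : ℂ => C * ‖u - c‖ := by fun_prop
      have h1 := (this.tendsto c).mono_left (nhdsWithin_le_nhds (s := U))
      simpa using h1
  · intro c hc y hy
    rw [movedSet_bundleLift h]
    exact (hs c hc).encode_mem (hw.trace_mem hc (h.decode_mem hy))
  · intro c hc
    rw [movedSet_bundleLift h, h.cantorBundle_eq]
    rintro _ ⟨_, ⟨x, hx, rfl⟩, rfl⟩
    rw [bundleLift_encode h hx, hconj c hc x hx]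
    exact ⟨_, mem_image_of_mem _ (tail_mem_orbits hx 1), bundleLift_encode h (tail_mem_orbits hx 1) c⟩
  · intro c hc
    rw [movedSet_bundleLift h, h.cantorBundle_eq]
    rintro _ ⟨x, hx, rfl⟩
    rw [h.bundleMap_encode hx, bundleLift_encode h hx, bundleLift_encode h (tail_mem_orbits hx 1),
      hconj c hc x hx]
  · obtain ⟨C, hC, hL⟩ := hw.lipschitz
    have h1 : 0 < 1 - δ := by linarith
    have hr := h.r_pos
    refine ⟨(1 + r / (1 - δ)) * C, by positivity, fun u hu v hv y hy => ?_⟩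
    have hx := h.decode_mem hy
    rw [mul_assoc]
    exact norm_encode_sub_le hr.le h.δ_pos.le hδ1 (fun i => hR u hu _ (tail_mem_orbits hx i))
      (fun i => hR v hv _ (tail_mem_orbits hx i)) fun i => hL u hu v hv _ (tail_mem_orbits hx i)

/-- The motion of orbits given by a motion of the Cantor bundle. -/
noncomputable def orbitPart (r δ : ℝ) (h : ℂ → ℂ × ℂ → ℂ × ℂ) (c : ℂ) (x : ℕ → ℂ) : ℂ :=
  (h c (encode r δ x)).1

variable {h : ℂ → ℂ × ℂ → ℂ × ℂ}

theorem IsBundleMotion.iterate (hh : IsBundleMotion p q k c₀ Λ r δ U h)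
    (h0 : IsBundleScale p q c₀ Λ r δ) (hc : c ∈ U) {x : ℕ → ℂ} (hx : x ∈ orbits p q k c₀ Λ)
    (n : ℕ) : h c (encode r δ (tail n x)) =
      (bundleMap p q k c (movedSet p q k c₀ Λ r δ h c) r δ)^[n] (h c (encode r δ x)) := by
  induction n with
  | zero => rfl
  | succ n ih =>
    rw [Function.iterate_succ_apply', ← ih, ← hh.conj c hc _ (h0.encode_mem (tail_mem_orbits hx n)),
      h0.bundleMap_encode (tail_mem_orbits hx n), tail_tail, add_comm]

/-- The conjugacy turns shifts of `x` into iterates of the bundle map on the moved point. So the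
first coordinates of `h c` along the shifts recover all of `h c (encode r δ x)`, and injectivity
passes from `h c` to the traces. -/
theorem IsBundleMotion.trace_orbitPart (hh : IsBundleMotion p q k c₀ Λ r δ U h)
    (h0 : IsBundleScale p q c₀ Λ r δ) (hc : c ∈ U) {x : ℕ → ℂ} (hx : x ∈ orbits p q k c₀ Λ) :
    trace (orbitPart r δ h) c x =
      decode p q k c (movedSet p q k c₀ Λ r δ h c) r δ (h c (encode r δ x)) := by
  funext n
  rw [trace, orbitPart, hh.iterate h0 hc hx n, decode]

theorem image_orbitPart (h0 : IsBundleScale p q c₀ Λ r δ) (h : ℂ → ℂ × ℂ → ℂ × ℂ) (c : ℂ) :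
    orbitPart r δ h c '' orbits p q k c₀ Λ = movedSet p q k c₀ Λ r δ h c := by
  rw [movedSet, h0.cantorBundle_eq, image_image, image_image]
  rfl

/-- A bundle motion gives a motion of orbits. -/
theorem IsBundleMotion.isOrbitMotion (hh : IsBundleMotion p q k c₀ Λ r δ U h)
    (h0 : IsBundleScale p q c₀ Λ r δ) :
    IsOrbitMotion p q k c₀ Λ U (orbitPart r δ h) := by
  have hmem : ∀ c ∈ U, ∀ x ∈ orbits p q k c₀ Λ, h c (encode r δ x) ∈
      cantorBundle p q k c (movedSet p q k c₀ Λ r δ h c) r δ := fun c hc x hx =>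
    hh.mapsTo c hc (h0.encode_mem hx)
  refine ⟨hh.bounded, hh.motion.isOpen, hh.motion.isConnected, hh.motion.base_mem, ?_, ?_, ?_, ?_,
    ?_, ?_⟩
  · intro x hx
    rw [orbitPart, hh.motion.base _ (h0.encode_mem hx), encode_fst]
  · intro c hc x hx
    have := ((hh.scale c hc).decode_mem (hmem c hc x hx)).2 0
    rwa [← hh.trace_orbitPart h0 hc hx] at this
  · intro c hc x hx y hy he
    rw [hh.trace_orbitPart h0 hc hx, hh.trace_orbitPart h0 hc hy] at he
    have h1 := congrArg (encode r δ) he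
    rw [(hh.scale c hc).encode_decode (hmem c hc x hx),
      (hh.scale c hc).encode_decode (hmem c hc y hy)] at h1
    have h2 := hh.motion.injOn c hc (h0.encode_mem hx) (h0.encode_mem hy) h1
    rw [← h0.decode_encode hx, h2, h0.decode_encode hy]
  · intro x hx
    exact (hh.motion.holomorphic _ (h0.encode_mem hx)).fst
  · intro c hc
    rw [image_orbitPart h0]
    exact hh.hyperbolic c hc
  · obtain ⟨C, hC, hL⟩ := hh.lipschitz
    exact ⟨C, hC, fun u hu v hv x hx =>
      (norm_fst_le _).trans (hL u hu v hv _ (h0.encode_mem hx))⟩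

/-! ### Solenoidal extensions and induced multifunctions -/

/-- The orbits that a subset of the Cantor bundle encodes. -/
def codedOrbits (p q : ℕ) (k : HypKind) (c₀ : ℂ) (Λ : Set ℂ) (r δ : ℝ) (S : Set (ℂ × ℂ)) :
    Set (ℕ → ℂ) :=
  decode p q k c₀ Λ r δ '' S

variable {S : Set (ℂ × ℂ)}

theorem codedOrbits_subset (h0 : IsBundleScale p q c₀ Λ r δ)
    (hS : S ⊆ cantorBundle p q k c₀ Λ r δ) :
    codedOrbits p q k c₀ Λ r δ S ⊆ orbits p q k c₀ Λ :=
  image_subset_iff.2 fun _ hy => h0.decode_mem (hS hy)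

/-- In terms of orbits the induced multifunction involves only the coded orbits and the motion of
first points, which is where the scale disappears. -/
theorem inducedMulti_eq (h0 : IsBundleScale p q c₀ Λ r δ)
    (hS : S ⊆ cantorBundle p q k c₀ Λ r δ) (h : ℂ → ℂ × ℂ → ℂ × ℂ) (c z : ℂ) :
    inducedMulti S h c z =
      {w | ∃ x ∈ codedOrbits p q k c₀ Λ r δ S, x 0 = z ∧ orbitPart r δ h c x = w} := by
  ext w
  constructor
  · rintro ⟨y, hy, h1, h2⟩
    refine ⟨_, mem_image_of_mem _ hy, h1, ?_⟩
    rw [orbitPart, h0.encode_decode (hS hy)]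
    exact h2
  · rintro ⟨_, ⟨y, hy, rfl⟩, h1, h2⟩
    refine ⟨y, hy, h1, ?_⟩
    rwa [orbitPart, h0.encode_decode (hS hy)] at h2

theorem codedOrbits_changeScale {r' δ' : ℝ} (h0 : IsBundleScale p q c₀ Λ r δ)
    (h0' : IsBundleScale p q c₀ Λ r' δ') (hS : S ⊆ cantorBundle p q k c₀ Λ r δ) :
    codedOrbits p q k c₀ Λ r' δ' (changeScale p q k c₀ Λ r δ r' δ' '' S) =
      codedOrbits p q k c₀ Λ r δ S := by
  rw [codedOrbits, image_image]
  refine image_congr fun y hy => ?_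
  rw [changeScale_eq, h0'.decode_encode (h0.decode_mem (hS hy))]

theorem IsSolenoidalExtension.changeScale {r' δ' : ℝ}
    (hS : IsSolenoidalExtension p q k c₀ Λ r δ S) (h0 : IsBundleScale p q c₀ Λ r δ)
    (h0' : IsBundleScale p q c₀ Λ r' δ') :
    IsSolenoidalExtension p q k c₀ Λ r' δ' (changeScale p q k c₀ Λ r δ r' δ' '' S) := by
  refine ⟨?_, ?_, ?_⟩
  · rintro _ ⟨y, hy, rfl⟩
    exact h0'.encode_mem (h0.decode_mem (hS.subset hy))
  · rintro _ ⟨y, hy, rfl⟩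
    refine ⟨_, hS.invariant hy, ?_⟩
    have hx := h0.decode_mem (hS.subset hy)
    rw [changeScale_eq, changeScale_eq, h0'.bundleMap_encode hx]
    -- Decoding the image under the bundle map is, by definition, the shifted decoding.
    congr 1
  · rw [← hS.surjective, image_image]
    rfl

/-! ### Normality -/

/-- A sequence of uniformly Lipschitz, uniformly bounded functions on a bounded set has a uniformly
convergent subsequence. -/
theorem exists_subseq_tendstoUniformlyOn {U : Set ℂ} (hU : Bornology.IsBounded U) {C R : ℝ}
    (f : ℕ → ℂ → ℂ) (hC : 0 < C) (hR : ∀ n, ∀ c ∈ U, ‖f n c‖ ≤ R)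
    (hL : ∀ n, ∀ u ∈ U, ∀ v ∈ U, ‖f n u - f n v‖ ≤ C * ‖u - v‖) :
    ∃ (φ : ℕ → ℕ) (g : ℂ → ℂ), StrictMono φ ∧ TendstoUniformlyOn (fun n => f (φ n)) g atTop U := by
  have hnet : ∀ n : ℕ, ∃ t ⊆ U, t.Finite ∧ U ⊆ ⋃ y ∈ t, ball y (1 / ((n : ℝ) + 1)) := fun n =>
    Metric.finite_approx_of_totallyBounded (hU.isCompact_closure.totallyBounded.subset subset_closure) _
      (by positivity)
  choose t htU htf htc using hnet
  have : Countable (⋃ n, t n) := (countable_iUnion fun n => (htf n).countable).to_subtype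
  have hDU : ∀ y ∈ ⋃ n, t n, y ∈ U := iUnion_subset htU
  -- The union of the nets is countable, so this compact product is first countable and hence
  -- sequentially compact. This replaces the diagonal argument.
  have hK : IsCompact (Set.pi univ fun _ : ⋃ n, t n => closedBall (0 : ℂ) R) :=
    isCompact_univ_pi fun _ => isCompact_closedBall 0 R
  obtain ⟨a, -, φ, hφ, ha⟩ := hK.isSeqCompact
    (x := fun n (y : ⋃ n, t n) => f n y) fun n y _ => by
      simpa using hR n y (hDU y y.2)
  have hcauchy : UniformCauchySeqOn (fun n => f (φ n)) atTop U := by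
    rw [Metric.uniformCauchySeqOn_iff]
    intro ε hε
    -- On a net this fine, moving to the nearest net point changes every function by at most `ε /
    -- 4`.
    obtain ⟨m, hm⟩ := exists_nat_one_div_lt (show 0 < ε / (4 * C) by positivity)
    have h1 : ∀ y ∈ t m, ∃ N, ∀ n ≥ N, ∀ n' ≥ N, dist (f (φ n) y) (f (φ n') y) < ε / 4 := by
      intro y hy
      have := ((tendsto_pi_nhds.1 ha) ⟨y, mem_iUnion.2 ⟨m, hy⟩⟩).cauchySeq
      obtain ⟨N, hN⟩ := Metric.cauchySeq_iff.1 this (ε / 4) (by positivity)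
      exact ⟨N, hN⟩
    choose! N hN using h1
    obtain ⟨M, hM⟩ := ((htf m).image N).bddAbove
    refine ⟨M, fun n hn n' hn' c hc => ?_⟩
    obtain ⟨y, hy, hcy⟩ := mem_iUnion₂.1 (htc m hc)
    have hNM : N y ≤ M := hM (mem_image_of_mem _ hy)
    have h2 := hN y hy n (hNM.trans hn) n' (hNM.trans hn')
    have hcy' : C * ‖c - y‖ ≤ ε / 4 := by
      rw [← dist_eq_norm]
      calc C * dist c y ≤ C * (ε / (4 * C)) := by
            have := (mem_ball.1 hcy).trans hm
            gcongr
        _ = ε / 4 := by field_simp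
    have h3 : ∀ n, dist (f n c) (f n y) ≤ ε / 4 := fun n => by
      rw [dist_eq_norm]
      exact (hL n c hc y (htU m hy)).trans hcy'
    calc dist (f (φ n) c) (f (φ n') c)
        ≤ dist (f (φ n) c) (f (φ n) y) + dist (f (φ n) y) (f (φ n') y) +
          dist (f (φ n') y) (f (φ n') c) := dist_triangle4 _ _ _ _
      _ < ε / 4 + ε / 4 + ε / 4 := by
          have := h3 (φ n')
          rw [dist_comm] at this
          linarith [h3 (φ n)]
      _ < ε := by linarith
  have hlim : ∀ c, ∃ b, c ∈ U → Tendsto (fun n => f (φ n) c) atTop (𝓝 b) := fun c => by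
    by_cases hc : c ∈ U
    · obtain ⟨b, hb⟩ := cauchySeq_tendsto_of_complete (hcauchy.cauchySeq hc)
      exact ⟨b, fun _ => hb⟩
    · exact ⟨0, fun h => absurd h hc⟩
  choose g hg using hlim
  exact ⟨φ, g, hφ, hcauchy.tendstoUniformlyOn_of_tendsto fun c hc => hg c hc⟩

/-- The multifunction induced by a bundle motion is a normal branched holomorphic motion. -/
theorem IsBundleMotion.isNormalBranchedMotion (hh : IsBundleMotion p q k c₀ Λ r δ U h)
    (hS : IsSolenoidalExtension p q k c₀ Λ r δ S) :
    IsNormalBranchedMotion U Λ c₀ (inducedMulti S h) := by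
  have hSz : ∀ z ∈ Λ, ∃ y ∈ S, y.1 = z := fun z hz => by
    rw [← hS.surjective] at hz
    exact hz
  refine ⟨hh.motion.isOpen, hh.motion.isConnected, hh.motion.base_mem, ?_, ?_,
    (fun y c => (h c y).1) '' S, ?_, ?_, ?_⟩
  · intro c _ z hz
    obtain ⟨y, hy, rfl⟩ := hSz z hz
    exact ⟨_, y, hy, rfl, rfl⟩
  · intro z hz
    obtain ⟨y, hy, rfl⟩ := hSz z hz
    ext v
    constructor
    · rintro ⟨y', hy', h1, rfl⟩
      rw [hh.motion.base _ (hS.subset hy'), h1]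
      rfl
    · rintro rfl
      exact ⟨y, hy, rfl, by rw [hh.motion.base _ (hS.subset hy)]⟩
  · rintro _ ⟨y, hy, rfl⟩
    exact (hh.motion.holomorphic y (hS.subset hy)).fst
  · ext ⟨c, v⟩
    simp only [mem_iUnion, exists_prop, mem_ofPred_eq, Set.mem_graphOn]
    constructor
    · rintro ⟨z, hz, hc, y, hy, -, rfl⟩
      exact ⟨_, mem_image_of_mem _ hy, hc, rfl⟩
    · rintro ⟨_, ⟨y, hy, rfl⟩, hc, rfl⟩
      exact ⟨y.1, (hS.subset hy).1, hc, y, hy, rfl, rfl⟩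
  · intro f hf
    choose y hy hfy using hf
    obtain ⟨C, hC, hL⟩ := hh.lipschitz
    obtain ⟨φ, g, hφ, hg⟩ := exists_subseq_tendstoUniformlyOn hh.bounded f hC
      -- Admissibility at every `c` keeps all moved points inside the disk of radius `1 / (2 * r)`.
      (R := 1 / (2 * r)) (fun n c hc => by
        rw [← hfy n]
        exact (hh.scale c hc).norm_le
          (mem_image_of_mem _ (mem_image_of_mem _ (hS.subset (hy n)))))
      (fun n u hu v hv => by
        rw [← hfy n]
        exact (norm_fst_le (h u (y n) - h v (y n))).trans (hL u hu v hv _ (hS.subset (hy n))))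
    exact ⟨φ, g, hφ, hg.tendstoLocallyUniformlyOn⟩

end PowerCorr

namespace PowerCorr

/-! ### Derivatives of the branches -/

/-- The modulus of the derivative at `z` of any branch of the correspondence. -/
noncomputable def expansion (p q : ℕ) (z : ℂ) : ℝ := (p / q : ℝ) * ‖z‖ ^ ((p : ℝ) / q - 1)

variable {p q : ℕ}

theorem one_lt_div_exponents (hq : 2 ≤ q) (hpq : q < p) : (1 : ℝ) < p / q := by
  have h1 : (0 : ℝ) < q := by exact_mod_cast (by omega : 0 < q)
  rw [one_lt_div h1]
  exact_mod_cast hpq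

theorem continuous_expansion (hq : 2 ≤ q) (hpq : q < p) : Continuous (expansion p q) := by
  have h := one_lt_div_exponents hq hpq
  exact continuous_const.mul
    ((Real.continuous_rpow_const (by linarith)).comp continuous_norm)

theorem expansion_zero (hq : 2 ≤ q) (hpq : q < p) : expansion p q 0 = 0 := by
  have h := one_lt_div_exponents hq hpq
  rw [expansion, norm_zero, Real.zero_rpow (by linarith), mul_zero]

theorem CorrRel.norm_sub {c z w : ℂ} (hq : 2 ≤ q) (h : CorrRel p q c z w) :
    ‖w - c‖ = ‖z‖ ^ ((p : ℝ) / q) := by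
  have hq0 : q ≠ 0 := by omega
  have h1 : ‖w - c‖ ^ q = (‖z‖ ^ ((p : ℝ) / q)) ^ q := by
    rw [← norm_pow, h, norm_pow, ← Real.rpow_mul_natCast (norm_nonneg z),
      div_mul_cancel₀ _ (by exact_mod_cast hq0), Real.rpow_natCast]
  exact (pow_left_inj₀ (norm_nonneg _) (by positivity) hq0).1 h1

/-- This is the modulus of the implicitly differentiated equation `q (w - c)^(q-1) w' = p z^(p-1)`,
with no branch needed. It is checked after multiplication by `‖z‖ * ‖w - c‖`, which restores the
full powers. -/
theorem CorrRel.mul_expansion {c z w : ℂ} (hq : 2 ≤ q) (hpq : q < p) (h : CorrRel p q c z w)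
    (hz : z ≠ 0) : q * ‖w - c‖ ^ (q - 1) * expansion p q z = p * ‖z‖ ^ (p - 1) := by
  have hz0 : 0 < ‖z‖ := norm_pos_iff.2 hz
  have hm := h.norm_sub hq
  have hm0 : 0 < ‖w - c‖ := by rw [hm]; positivity
  have hq0 : (q : ℝ) ≠ 0 := by exact_mod_cast (by omega : q ≠ 0)
  have h1 : expansion p q z * ‖z‖ = p / q * ‖w - c‖ := by
    rw [expansion, mul_assoc, hm, ← Real.rpow_add_one hz0.ne', sub_add_cancel]
  have h2 : ‖w - c‖ ^ (q - 1) * ‖w - c‖ = ‖w - c‖ ^ q := pow_sub_one_mul (by omega) _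
  have h3 : ‖z‖ ^ (p - 1) * ‖z‖ = ‖z‖ ^ p := pow_sub_one_mul (by omega) _
  have h4 : ‖w - c‖ ^ q = ‖z‖ ^ p := by rw [← norm_pow, h, norm_pow]
  have h5 : (q * ‖w - c‖ ^ (q - 1) * expansion p q z) * (‖z‖ * ‖w - c‖) =
      (p * ‖z‖ ^ (p - 1)) * (‖z‖ * ‖w - c‖) := by
    calc _ = q * (‖w - c‖ ^ (q - 1) * ‖w - c‖) * (expansion p q z * ‖z‖) := by ring
      _ = p * (‖z‖ ^ (p - 1) * ‖z‖) * ‖w - c‖ := by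
          rw [h1, h2, h3, h4]
          field_simp
      _ = _ := by ring
  exact mul_right_cancel₀ (by positivity) h5

theorem IsBranchAt.corrRel {c z : ℂ} {φ : ℂ → ℂ} (h : IsBranchAt p q c φ z) :
    CorrRel p q c z (φ z) := h.self_of_nhds.2

/-- Away from `0`, differentiate `(φ x - c)^q = x^p`. At `0` that equation gives no information;
instead the difference quotient has modulus `‖x‖^(p/q - 1)`, which tends to `0` since `p > q`. -/
theorem IsBranchAt.norm_deriv {c z : ℂ} {φ : ℂ → ℂ} (hq : 2 ≤ q) (hpq : q < p)
    (h : IsBranchAt p q c φ z) : ‖deriv φ z‖ = expansion p q z := by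
  have hd : HasDerivAt φ (deriv φ z) z := h.self_of_nhds.1.hasDerivAt
  have hrel := h.corrRel
  rcases eq_or_ne z 0 with rfl | hz
  · have h1 := (hasDerivAt_iff_tendsto_slope.1 hd).norm
    have h0 : φ 0 = c := by
      have h2 := hrel.norm_sub hq
      have h3 := one_lt_div_exponents hq hpq
      rw [norm_zero, Real.zero_rpow (by linarith), norm_eq_zero, sub_eq_zero] at h2
      exact h2
    have h2 : Tendsto (fun x : ℂ => (q / p : ℝ) * expansion p q x) (𝓝[≠] 0) (𝓝 0) := by
      have := ((continuous_expansion hq hpq).tendsto 0).mono_left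
        (nhdsWithin_le_nhds (s := ({0}ᶜ : Set ℂ)))
      rw [expansion_zero hq hpq] at this
      simpa using this.const_mul (q / p : ℝ)
    rw [expansion_zero hq hpq]
    refine tendsto_nhds_unique (h1.congr' ?_) h2
    filter_upwards [self_mem_nhdsWithin, nhdsWithin_le_nhds h] with x hx hbx
    have hx0 : 0 < ‖x‖ := norm_pos_iff.2 hx
    have hp0 : (p : ℝ) ≠ 0 := by exact_mod_cast (by omega : p ≠ 0)
    have hq0 : (q : ℝ) ≠ 0 := by exact_mod_cast (by omega : q ≠ 0)
    rw [slope_def_field, h0, sub_zero, norm_div, hbx.2.norm_sub hq, expansion,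
      Real.rpow_sub_one hx0.ne']
    field_simp
  · have h1 : HasDerivAt (fun x => (φ x - c) ^ q) (q * (φ z - c) ^ (q - 1) * deriv φ z) z :=
      (hd.sub_const c).pow q
    have h2 : HasDerivAt (fun x : ℂ => x ^ p) (p * z ^ (p - 1)) z := hasDerivAt_pow p z
    have h3 := h1.congr_of_eventuallyEq (f₁ := fun x : ℂ => x ^ p)
      (h.mono fun x hx => hx.2.symm)
    have h4 := congrArg norm (h3.unique h2)
    simp only [norm_mul, norm_pow, Complex.norm_natCast] at h4
    have h5 := hrel.mul_expansion hq hpq hz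
    have hm := hrel.norm_sub hq
    have hm0 : 0 < ‖φ z - c‖ := by
      have hz0 : 0 < ‖z‖ := norm_pos_iff.2 hz
      rw [hm]; positivity
    have hq0 : (0 : ℝ) < q := by exact_mod_cast (by omega : 0 < q)
    refine mul_left_cancel₀ (?_ : (q * ‖φ z - c‖ ^ (q - 1)) ≠ 0) (h4.trans h5.symm)
    positivity

theorem cpow_div_natCast_pow (x : ℂ) (m : ℕ) {n : ℕ} (hn : n ≠ 0) :
    (x ^ ((m : ℂ) / n)) ^ n = x ^ m := by
  rw [← Complex.cpow_nat_mul, mul_div_cancel₀ _ (by exact_mod_cast hn), Complex.cpow_natCast]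

/-- Dividing by `z` moves the base point to `1`, where the principal power is holomorphic; the
factor `w - c` selects the branch through `w`. -/
theorem exists_isBranchAt {c z w : ℂ} (hq : 2 ≤ q) (h : CorrRel p q c z w) (hz : z ≠ 0) :
    ∃ φ, IsBranchAt p q c φ z ∧ φ z = w := by
  refine ⟨fun x => c + (w - c) * (x / z) ^ ((p : ℂ) / q), ?_, by simp [hz]⟩
  have h1 : ∀ᶠ x in 𝓝 z, x / z ∈ Complex.slitPlane := by
    refine (continuous_id.div_const z).continuousAt.eventually_mem
      (Complex.isOpen_slitPlane.mem_nhds ?_)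
    simp [hz]
  filter_upwards [h1] with x hx
  refine ⟨?_, ?_⟩
  · refine (DifferentiableAt.const_mul ?_ _).const_add _
    exact (differentiableAt_id.div_const z).cpow_const (c := (p : ℂ) / q) hx
  · rw [CorrRel, add_sub_cancel_left, mul_pow, cpow_div_natCast_pow _ _ (by omega), h, div_pow,
      mul_div_cancel₀ _ (pow_ne_zero p hz)]

/-! ### Hyperbolic metrics without branches -/

/-- Uniform expansion (contraction) by the factor `l⁻¹` (by `l`) along pairs of the
correspondence. -/
def HasHypFactor (p q : ℕ) (c : ℂ) (V : Set ℂ) (μ : ℂ → ℝ) (l : ℝ) : HypKind → Prop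
  | .expanding => ∀ z ∈ V, ∀ w ∈ V, CorrRel p q c z w → μ z ≤ l * (expansion p q z * μ w)
  | .attracting => ∀ z ∈ V, ∀ w ∈ V, CorrRel p q c z w → expansion p q z * μ w ≤ l * μ z

variable {c : ℂ} {V : Set ℂ} {μ : ℂ → ℝ} {k : HypKind}

theorem HasHypFactor.isHyperbolicMetric {l : ℝ} (hq : 2 ≤ q) (hpq : q < p) (hl0 : 0 < l)
    (hl1 : l < 1) (hμ : ∀ z ∈ V, 0 < μ z) (h : HasHypFactor p q c V μ l k) :
    IsHyperbolicMetric p q c V μ k := by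
  cases k with
  | expanding =>
    refine ⟨l⁻¹, (one_lt_inv₀ hl0).2 hl1, fun z hz φ hφ hφz => ?_⟩
    have h1 := h z hz _ hφz hφ.corrRel
    rw [derivNorm, hφ.norm_deriv hq hpq, le_div_iff₀ (hμ z hz), inv_mul_le_iff₀ hl0]
    exact h1
  | attracting =>
    refine ⟨l, hl1, fun z hz φ hφ hφz => ?_⟩
    have h1 := h z hz _ hφz hφ.corrRel
    rw [derivNorm, hφ.norm_deriv hq hpq, div_le_iff₀ (hμ z hz)]
    exact h1

/-- Every related pair with `z ≠ 0` lies on a branch, so only `z = 0` needs care, where a branch may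
fail to exist. In the expanding case the inequality at `0` is the limit of those at nearby points;
as the expansion vanishes there, it in fact excludes `0` and `c` from lying in `V` together. In the
attracting case it is trivial. -/
theorem IsHyperbolicMetric.exists_hasHypFactor (hq : 2 ≤ q) (hpq : q < p) (hV : IsOpen V)
    (hc : ContinuousOn μ V) (hμ : ∀ z ∈ V, 0 < μ z) (h : IsHyperbolicMetric p q c V μ k) :
    ∃ l, 0 < l ∧ l < 1 ∧ HasHypFactor p q c V μ l k := by
  cases k with
  | expanding =>
    obtain ⟨l, hl, h⟩ := h
    have hl0 : 0 < l := by linarith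
    have key : ∀ z ∈ V, ∀ w ∈ V, CorrRel p q c z w → z ≠ 0 → μ z ≤ l⁻¹ * (expansion p q z * μ w) := by
      intro z hz w hw hr hz0
      obtain ⟨φ, hφ, rfl⟩ := exists_isBranchAt hq hr hz0
      have h1 := h z hz φ hφ hw
      rw [derivNorm, hφ.norm_deriv hq hpq, le_div_iff₀ (hμ z hz)] at h1
      rwa [le_inv_mul_iff₀ hl0]
    refine ⟨l⁻¹, by positivity, inv_lt_one_of_one_lt₀ hl, fun z hz w hw hr => ?_⟩
    rcases eq_or_ne z 0 with rfl | hz0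
    · have h3 := one_lt_div_exponents hq hpq
      have hwc : w = c := by
        have h2 := hr.norm_sub hq
        rw [norm_zero, Real.zero_rpow (by linarith), norm_eq_zero, sub_eq_zero] at h2
        exact h2
      subst hwc
      have hroot : ∀ z : ℂ, ∃ v, CorrRel p q w z v := fun z =>
        ⟨w + (z ^ p) ^ ((1 : ℕ) / q : ℂ), by
          rw [CorrRel, add_sub_cancel_left, cpow_div_natCast_pow _ _ (by omega), pow_one]⟩
      choose v hv using hroot
      have hvlim : Tendsto v (𝓝 0) (𝓝 w) := by
        rw [tendsto_iff_norm_sub_tendsto_zero]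
        simp only [fun z => (hv z).norm_sub hq]
        have : Continuous fun z : ℂ => ‖z‖ ^ ((p : ℝ) / q) :=
          (Real.continuous_rpow_const (by linarith)).comp continuous_norm
        have h4 := this.tendsto 0
        rwa [norm_zero, Real.zero_rpow (by linarith)] at h4
      have h5 : Tendsto μ (𝓝 0) (𝓝 (μ 0)) := hc.continuousAt (hV.mem_nhds hz)
      have h6 : Tendsto (fun z => μ (v z)) (𝓝 0) (𝓝 (μ w)) :=
        (hc.continuousAt (hV.mem_nhds hw)).tendsto.comp hvlim
      have h7 := (((continuous_expansion hq hpq).tendsto 0).mul h6).const_mul l⁻¹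
      refine le_of_tendsto_of_tendsto (b := 𝓝[≠] (0 : ℂ)) (h5.mono_left nhdsWithin_le_nhds)
        (h7.mono_left nhdsWithin_le_nhds) ?_
      filter_upwards [self_mem_nhdsWithin, nhdsWithin_le_nhds (hV.mem_nhds hz),
        nhdsWithin_le_nhds (hvlim.eventually_mem (hV.mem_nhds hw))] with x hx hxV hvV
      exact key x hxV _ hvV (hv x) hx
    · exact key z hz w hw hr hz0
  | attracting =>
    obtain ⟨l, hl, h⟩ := h
    -- The given bound `l` need not be positive, hence the maximum with `1 / 2`.
    refine ⟨max l (1 / 2), by positivity, max_lt hl (by norm_num), fun z hz w hw hr => ?_⟩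
    rcases eq_or_ne z 0 with rfl | hz0
    · rw [expansion_zero hq hpq, zero_mul]
      exact mul_nonneg (by positivity) (hμ _ hz).le
    · obtain ⟨φ, hφ, rfl⟩ := exists_isBranchAt hq hr hz0
      have h1 := h z hz φ hφ hw
      rw [derivNorm, hφ.norm_deriv hq hpq, div_le_iff₀ (hμ z hz)] at h1
      exact h1.trans (mul_le_mul_of_nonneg_right (le_max_left _ _) (hμ z hz).le)

/-! ### The two directions in a common form -/

namespace HypKind

/-- `Step p q k c u v` reads `(u - k.lshift * c) ^ k.lexp = (v - k.rshift * c) ^ k.rexp`. -/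
def lshift : HypKind → ℂ
  | .expanding => 0
  | .attracting => 1

/-- See `HypKind.lshift`. -/
def rshift : HypKind → ℂ
  | .expanding => 1
  | .attracting => 0

/-- See `HypKind.lshift`. -/
def lexp (p q : ℕ) : HypKind → ℕ
  | .expanding => p
  | .attracting => q

/-- See `HypKind.lshift`. -/
def rexp (p q : ℕ) : HypKind → ℕ
  | .expanding => q
  | .attracting => p

theorem norm_lshift_le (k : HypKind) : ‖k.lshift‖ ≤ 1 := by cases k <;> simp [lshift]

theorem norm_rshift_le (k : HypKind) : ‖k.rshift‖ ≤ 1 := by cases k <;> simp [rshift]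

theorem lexp_ne_zero (hq : 2 ≤ q) (hpq : q < p) (k : HypKind) : k.lexp p q ≠ 0 := by
  cases k <;> simp only [lexp] <;> omega

theorem rexp_ne_zero (hq : 2 ≤ q) (hpq : q < p) (k : HypKind) : k.rexp p q ≠ 0 := by
  cases k <;> simp only [rexp] <;> omega

end HypKind

theorem step_iff {u v : ℂ} : Step p q k c u v ↔
    (u - k.lshift * c) ^ k.lexp p q = (v - k.rshift * c) ^ k.rexp p q := by
  cases k
  · simp [Step, CorrRel, HypKind.lshift, HypKind.rshift, HypKind.lexp, HypKind.rexp, eq_comm]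
  · simp [Step, CorrRel, HypKind.lshift, HypKind.rshift, HypKind.lexp, HypKind.rexp]

theorem sub_ne_zero_of_corrRel {z w : ℂ} (hq : 2 ≤ q) (h : CorrRel p q c z w) (hz : z ≠ 0) :
    w - c ≠ 0 := by
  intro h0
  rw [CorrRel, h0, zero_pow (by omega)] at h
  exact pow_ne_zero p hz h.symm

theorem Step.left_ne_zero {u v : ℂ} (hq : 2 ≤ q) (h : Step p q k c u v)
    (hu : u ≠ 0) (hv : v ≠ 0) : u - k.lshift * c ≠ 0 := by
  cases k
  · simpa [HypKind.lshift] using hu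
  · simpa [HypKind.lshift] using sub_ne_zero_of_corrRel hq h hv

theorem Step.right_ne_zero {u v : ℂ} (hq : 2 ≤ q) (h : Step p q k c u v)
    (hu : u ≠ 0) (hv : v ≠ 0) : v - k.rshift * c ≠ 0 := by
  cases k
  · simpa [HypKind.rshift] using sub_ne_zero_of_corrRel hq h hu
  · simpa [HypKind.rshift] using hv

/-- Differentiating the step relation gives `|du/dv|` as the quotient of the two power derivatives.
With denominators cleared, the inequality reads `μ u |du| ≤ l μ v |dv|`: in both types the step back
from `v` to `u` contracts. -/
theorem HasHypFactor.step_le {l : ℝ} (hq : 2 ≤ q) (hpq : q < p)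
    (h : HasHypFactor p q c V μ l k) {u v : ℂ} (hu : u ∈ V) (hv : v ∈ V) (hu0 : u ≠ 0)
    (hv0 : v ≠ 0) (hs : Step p q k c u v) :
    k.rexp p q * ‖v - k.rshift * c‖ ^ (k.rexp p q - 1) * μ u ≤
      l * (k.lexp p q * ‖u - k.lshift * c‖ ^ (k.lexp p q - 1) * μ v) := by
  cases k with
  | expanding =>
    have h1 := h u hu v hv hs
    have h2 := CorrRel.mul_expansion hq hpq hs hu0
    simp only [HypKind.lshift, HypKind.rshift, HypKind.lexp, HypKind.rexp, one_mul, zero_mul,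
      sub_zero]
    rw [← h2]
    calc _ ≤ q * ‖v - c‖ ^ (q - 1) * (l * (expansion p q u * μ v)) := by gcongr
      _ = _ := by ring
  | attracting =>
    have h1 := h v hv u hu hs
    have h2 := CorrRel.mul_expansion hq hpq hs hv0
    simp only [HypKind.lshift, HypKind.rshift, HypKind.lexp, HypKind.rexp, one_mul, zero_mul,
      sub_zero]
    rw [← h2]
    calc _ = q * ‖u - c‖ ^ (q - 1) * (expansion p q v * μ u) := by ring
      _ ≤ q * ‖u - c‖ ^ (q - 1) * (l * μ v) := by gcongr
      _ = _ := by ring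

/-! ### Uniform contraction along orbits -/

/-- The factor in `x ^ n - y ^ n = geomSum n x y * (x - y)`. -/
def geomSum (n : ℕ) (x y : ℂ) : ℂ := ∑ i ∈ Finset.range n, x ^ i * y ^ (n - 1 - i)

theorem geomSum_mul (n : ℕ) (x y : ℂ) : geomSum n x y * (x - y) = x ^ n - y ^ n :=
  (Commute.all x y).geom_sum₂_mul n

theorem geomSum_self (n : ℕ) (x : ℂ) : geomSum n x x = n * x ^ (n - 1) := geom_sum₂_self x n

theorem continuous_geomSum (n : ℕ) : Continuous fun z : ℂ × ℂ => geomSum n z.1 z.2 := by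
  unfold geomSum
  fun_prop

/-- Subtracting the two relations gives an exact identity between finite differences, with `geomSum`
in place of the derivatives. On the diagonal `geomSum` is the derivative, so `hbase` and `l < l'`
give a strict inequality on a compact set of pairs; it persists in a uniform neighbourhood. No path
between the points is needed, and the shifts by `c` and `c'` produce the linear error. -/
theorem exists_local_contraction {s t c₀ : ℂ} {a b : ℕ} {Λ : Set ℂ} {l l' : ℝ} (hs : ‖s‖ ≤ 1)
    (ht : ‖t‖ ≤ 1) (hΛ : IsCompact Λ) (hV : IsOpen V) (hΛV : Λ ⊆ V) (hc : ContinuousOn μ V)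
    (hμ : ∀ z ∈ V, 0 < μ z) (hl : l < l') (hl' : 0 ≤ l')
    (hbase : ∀ x ∈ Λ, ∀ y ∈ Λ, (x - s * c₀) ^ a = (y - t * c₀) ^ b →
      b * ‖y - t * c₀‖ ^ (b - 1) * μ x ≤ l * (a * ‖x - s * c₀‖ ^ (a - 1) * μ y) ∧
      0 < a * ‖x - s * c₀‖ ^ (a - 1)) :
    ∃ ε > 0, ∀ x ∈ Λ, ∀ y ∈ Λ, (x - s * c₀) ^ a = (y - t * c₀) ^ b →
      ∀ c c' u u' v v' : ℂ, ‖c - c₀‖ < ε → ‖c' - c₀‖ < ε → ‖u - x‖ < ε → ‖u' - x‖ < ε →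
        ‖v - y‖ < ε → ‖v' - y‖ < ε → (u - s * c) ^ a = (v - t * c) ^ b →
        (u' - s * c') ^ a = (v' - t * c') ^ b →
        μ x * ‖u - u'‖ ≤ l' * (μ y * ‖v - v'‖) + (μ x + l' * μ y) * ‖c - c'‖ := by
  let F : ℂ × ℂ → ℂ × ℂ × (ℂ × ℂ) × (ℂ × ℂ) := fun z =>
    (z.1, z.2, (z.1 - s * c₀, z.1 - s * c₀), (z.2 - t * c₀, z.2 - t * c₀))
  have hF : Continuous F := by fun_prop
  set K : Set (ℂ × ℂ) := (Λ ×ˢ Λ) ∩ {z | (z.1 - s * c₀) ^ a = (z.2 - t * c₀) ^ b}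
  have hK : IsCompact K := (hΛ.prod hΛ).inter_right (isClosed_eq (by fun_prop) (by fun_prop))
  let O : Set (ℂ × ℂ × (ℂ × ℂ) × (ℂ × ℂ)) := {z | z.1 ∈ V ∧ z.2.1 ∈ V} ∩
    {z | ‖geomSum b z.2.2.2.1 z.2.2.2.2‖ * μ z.1 < l' * (‖geomSum a z.2.2.1.1 z.2.2.1.2‖ * μ z.2.1)}
  have hO : IsOpen O := by
    have hVV : IsOpen {z : ℂ × ℂ × (ℂ × ℂ) × (ℂ × ℂ) | z.1 ∈ V ∧ z.2.1 ∈ V} :=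
      (hV.preimage continuous_fst).inter (hV.preimage (continuous_fst.comp continuous_snd))
    have h1 : ContinuousOn (fun z : ℂ × ℂ × (ℂ × ℂ) × (ℂ × ℂ) => μ z.1)
        {z | z.1 ∈ V ∧ z.2.1 ∈ V} := hc.comp continuous_fst.continuousOn fun z hz => hz.1
    have h2 : ContinuousOn (fun z : ℂ × ℂ × (ℂ × ℂ) × (ℂ × ℂ) => μ z.2.1)
        {z | z.1 ∈ V ∧ z.2.1 ∈ V} :=
      hc.comp (continuous_fst.comp continuous_snd).continuousOn fun z hz => hz.2
    have h3 : Continuous fun z : ℂ × ℂ × (ℂ × ℂ) × (ℂ × ℂ) => ‖geomSum b z.2.2.2.1 z.2.2.2.2‖ :=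
      ((continuous_geomSum b).comp (by fun_prop :
        Continuous fun z : ℂ × ℂ × (ℂ × ℂ) × (ℂ × ℂ) => z.2.2.2)).norm
    have h4 : Continuous fun z : ℂ × ℂ × (ℂ × ℂ) × (ℂ × ℂ) => ‖geomSum a z.2.2.1.1 z.2.2.1.2‖ :=
      ((continuous_geomSum a).comp (by fun_prop :
        Continuous fun z : ℂ × ℂ × (ℂ × ℂ) × (ℂ × ℂ) => z.2.2.1)).norm
    have h5 : ContinuousOn (fun z : ℂ × ℂ × (ℂ × ℂ) × (ℂ × ℂ) =>
        l' * (‖geomSum a z.2.2.1.1 z.2.2.1.2‖ * μ z.2.1) - ‖geomSum b z.2.2.2.1 z.2.2.2.2‖ * μ z.1)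
        {z | z.1 ∈ V ∧ z.2.1 ∈ V} :=
      ((h4.continuousOn.mul h2).const_mul l').sub (h3.continuousOn.mul h1)
    have h6 := h5.isOpen_inter_preimage hVV isOpen_Ioi (t := Ioi 0)
    convert h6 using 1
    ext z
    simp [O]
  have hKO : F '' K ⊆ O := by
    rintro _ ⟨⟨x, y⟩, ⟨⟨hx, hy⟩, hxy⟩, rfl⟩
    obtain ⟨h1, h2⟩ := hbase x hx y hy hxy
    refine ⟨⟨hΛV hx, hΛV hy⟩, ?_⟩
    have h3 := hμ y (hΛV hy)
    simp only [F, mem_ofPred_eq, geomSum_self, norm_mul, norm_pow, Complex.norm_natCast]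
    refine h1.trans_lt ?_
    gcongr
  obtain ⟨η, hη, hηO⟩ := (hK.image hF).exists_thickening_subset_open hO hKO
  -- Both `u` and `c` move the shifted coordinate `u - s * c`, hence half of `η` for each.
  refine ⟨η / 2, by positivity, ?_⟩
  intro x hx y hy hxy c c' u u' v v' hc1 hc2 hu hu' hv hv' hr hr'
  have hμx := hμ x (hΛV hx)
  have hμy := hμ y (hΛV hy)
  have hshift : ∀ {s u x c : ℂ}, ‖s‖ ≤ 1 → ‖u - x‖ < η / 2 → ‖c - c₀‖ < η / 2 →
      dist (u - s * c) (x - s * c₀) < η := by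
    intro s u x c hs hu hc
    rw [dist_eq_norm]
    calc ‖u - s * c - (x - s * c₀)‖ = ‖(u - x) - s * (c - c₀)‖ := by ring_nf
      _ ≤ ‖u - x‖ + ‖s * (c - c₀)‖ := norm_sub_le _ _
      _ ≤ ‖u - x‖ + 1 * ‖c - c₀‖ := by rw [norm_mul]; gcongr
      _ < η := by linarith
  have hmem : (x, y, (u - s * c, u' - s * c'), (v - t * c, v' - t * c')) ∈ O := by
    refine hηO (mem_thickening_iff.2 ⟨F (x, y), ⟨(x, y), ⟨⟨hx, hy⟩, hxy⟩, rfl⟩, ?_⟩)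
    simp only [F, Prod.dist_eq, dist_self, max_lt_iff]
    exact ⟨hη, hη, ⟨hshift hs hu hc1, hshift hs hu' hc2⟩, hshift ht hv hc1, hshift ht hv' hc2⟩
  have hlt : ‖geomSum b (v - t * c) (v' - t * c')‖ * μ x <
    l' * (‖geomSum a (u - s * c) (u' - s * c')‖ * μ y) := hmem.2
  set α := u - s * c with hα
  set α' := u' - s * c' with hα'
  set β := v - t * c with hβ
  set β' := v' - t * c' with hβ'
  have heq : ‖geomSum a α α'‖ * ‖α - α'‖ = ‖geomSum b β β'‖ * ‖β - β'‖ := by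
    rw [← norm_mul, ← norm_mul, geomSum_mul, geomSum_mul, hr, hr']
  have hA : 0 < ‖geomSum a α α'‖ := by
    refine (norm_nonneg _).lt_of_ne fun h0 => ?_
    -- A vanishing `geomSum` would make the right side of the strict inequality zero, while the left
    -- side is nonnegative.
    rw [← h0, zero_mul, mul_zero] at hlt
    exact absurd hlt (not_lt.2 (by positivity))
  have h1 : μ x * ‖α - α'‖ ≤ l' * (μ y * ‖β - β'‖) := by
    refine le_of_mul_le_mul_left ?_ hA
    calc ‖geomSum a α α'‖ * (μ x * ‖α - α'‖) = μ x * (‖geomSum a α α'‖ * ‖α - α'‖) := by ring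
      _ = (‖geomSum b β β'‖ * μ x) * ‖β - β'‖ := by rw [heq]; ring
      _ ≤ (l' * (‖geomSum a α α'‖ * μ y)) * ‖β - β'‖ := by gcongr
      _ = _ := by ring
  have h2 : ‖u - u'‖ ≤ ‖α - α'‖ + ‖c - c'‖ := by
    calc ‖u - u'‖ = ‖(α - α') + s * (c - c')‖ := by rw [hα, hα']; ring_nf
      _ ≤ ‖α - α'‖ + ‖s * (c - c')‖ := norm_add_le _ _
      _ ≤ ‖α - α'‖ + 1 * ‖c - c'‖ := by rw [norm_mul]; gcongr
      _ = _ := by ring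
  have h3 : ‖β - β'‖ ≤ ‖v - v'‖ + ‖c - c'‖ := by
    calc ‖β - β'‖ = ‖(v - v') - t * (c - c')‖ := by rw [hβ, hβ']; ring_nf
      _ ≤ ‖v - v'‖ + ‖t * (c - c')‖ := norm_sub_le _ _
      _ ≤ ‖v - v'‖ + 1 * ‖c - c'‖ := by rw [norm_mul]; gcongr
      _ = _ := by ring
  calc μ x * ‖u - u'‖ ≤ μ x * (‖α - α'‖ + ‖c - c'‖) := by gcongr
    _ = μ x * ‖α - α'‖ + μ x * ‖c - c'‖ := by ring
    _ ≤ l' * (μ y * ‖β - β'‖) + μ x * ‖c - c'‖ := by gcongr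
    _ ≤ l' * (μ y * (‖v - v'‖ + ‖c - c'‖)) + μ x * ‖c - c'‖ := by gcongr
    _ = _ := by ring

/-- Near the orbits in `Λ`, one step backwards along orbits contracts the weighted distance by the
factor `l`, up to an error that is linear in the change of the parameter. -/
structure IsContracting (p q : ℕ) (k : HypKind) (c₀ : ℂ) (Λ : Set ℂ) (μ : ℂ → ℝ)
    (m M B l ε : ℝ) : Prop where
  m_pos : 0 < m
  B_pos : 0 < B
  l_nonneg : 0 ≤ l
  l_lt : l < 1
  ε_pos : 0 < ε
  bounds : ∀ z ∈ Λ, m ≤ μ z ∧ μ z ≤ M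
  contraction : ∀ x ∈ Λ, ∀ y ∈ Λ, Step p q k c₀ x y →
      ∀ c c' u u' v v' : ℂ, ‖c - c₀‖ < ε → ‖c' - c₀‖ < ε → ‖u - x‖ < ε → ‖u' - x‖ < ε →
        ‖v - y‖ < ε → ‖v' - y‖ < ε → Step p q k c u v → Step p q k c' u' v' →
        μ x * ‖u - u'‖ ≤ l * (μ y * ‖v - v'‖) + B * ‖c - c'‖

theorem IsHyperbolicSet.exists_isContracting {c₀ : ℂ} {Λ : Set ℂ} (hq : 2 ≤ q) (hpq : q < p)
    (h : IsHyperbolicSet p q k c₀ Λ) :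
    ∃ (μ : ℂ → ℝ) (m M B l ε : ℝ), IsContracting p q k c₀ Λ μ m M B l ε := by
  obtain ⟨hΛ, V, μ, hV, -, hΛV, hc, hμ, hm⟩ := h
  obtain ⟨l, hl0, hl1, hf⟩ := hm.exists_hasHypFactor hq hpq hV hc hμ
  have hΛ0 : ∀ z ∈ Λ, z ≠ 0 := fun z hz h0 => hΛ.zero_notMem (h0 ▸ hz)
  obtain ⟨z₁, hz₁, hmin⟩ := hΛ.compact.exists_isMinOn hΛ.nonempty (hc.mono hΛV)
  obtain ⟨z₂, hz₂, hmax⟩ := hΛ.compact.exists_isMaxOn hΛ.nonempty (hc.mono hΛV)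
  have hM : 0 < μ z₂ := hμ _ (hΛV hz₂)
  obtain ⟨ε, hε, hcon⟩ := exists_local_contraction (a := k.lexp p q) (b := k.rexp p q)
    (c₀ := c₀) (l := l) (l' := (1 + l) / 2) k.norm_lshift_le
    k.norm_rshift_le hΛ.compact hV hΛV hc hμ (by linarith) (by linarith) fun x hx y hy hxy => by
      have hs := step_iff.2 hxy
      refine ⟨hf.step_le hq hpq (hΛV hx) (hΛV hy) (hΛ0 x hx) (hΛ0 y hy) hs, ?_⟩
      have h1 := norm_pos_iff.2 (hs.left_ne_zero hq (hΛ0 x hx) (hΛ0 y hy))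
      have h2 : (0 : ℝ) < k.lexp p q := by
        exact_mod_cast Nat.pos_of_ne_zero (k.lexp_ne_zero hq hpq)
      positivity
  -- The bounds `m` and `M` are the extrema of `μ` on `Λ`; `2 * μ z₂` dominates the coefficient `μ x
  -- + l' * μ y` of the parameter error, since `l' < 1`.
  refine ⟨μ, μ z₁, μ z₂, 2 * μ z₂, (1 + l) / 2, ε, hμ _ (hΛV hz₁), by positivity, by linarith,
    by linarith, hε, fun z hz => ⟨hmin hz, hmax hz⟩, ?_⟩
  intro x hx y hy hxy c c' u u' v v' h1 h2 h3 h4 h5 h6 h7 h8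
  refine (hcon x hx y hy (step_iff.1 hxy) c c' u u' v v' h1 h2 h3 h4 h5 h6 (step_iff.1 h7)
    (step_iff.1 h8)).trans ?_
  have hx' : μ x ≤ μ z₂ := hmax hx
  have hy' : μ y ≤ μ z₂ := hmax hy
  have hy0 := hμ y (hΛV hy)
  gcongr
  nlinarith

/-- The value `κ / (1 - l)` is the fixed point of `t ↦ l t + κ`. The excess over it shrinks by `l`
per step, so the uniform bound `R` far along the sequence is forgotten in the limit. -/
theorem le_of_le_mul_succ_add {d : ℕ → ℝ} {l κ R : ℝ} (hl0 : 0 ≤ l) (hl1 : l < 1)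
    (hd : ∀ i, d i ≤ l * d (i + 1) + κ) (hR : ∀ i, d i ≤ R) (i : ℕ) : d i ≤ κ / (1 - l) := by
  have h1 : 0 < 1 - l := by linarith
  have key : ∀ n i, d i - κ / (1 - l) ≤ l ^ n * (R - κ / (1 - l)) := by
    intro n
    induction n with
    | zero => intro i; simpa using hR i
    | succ n ih =>
      intro i
      have h2 := mul_le_mul_of_nonneg_left (ih (i + 1)) hl0
      have h3 : l * (κ / (1 - l)) + κ = κ / (1 - l) := by
        field_simp
        ring
      rw [pow_succ']
      nlinarith [hd i]
  have hlim : Tendsto (fun n => l ^ n * (R - κ / (1 - l))) atTop (𝓝 0) := by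
    simpa using (tendsto_pow_atTop_nhds_zero_of_lt_one hl0 hl1).mul_const (R - κ / (1 - l))
  linarith [ge_of_tendsto' hlim fun n => key n i]

variable {c₀ : ℂ} {Λ : Set ℂ} {m M B l ε : ℝ}

/-- Two orbits, for two parameters, that shadow the same orbit in `Λ` are close together. -/
theorem IsContracting.dist_shadows_le (h : IsContracting p q k c₀ Λ μ m M B l ε) {x : ℕ → ℂ}
    (hx : x ∈ orbits p q k c₀ Λ) {c c' : ℂ} (hc : ‖c - c₀‖ < ε) (hc' : ‖c' - c₀‖ < ε)
    {u u' : ℕ → ℂ} (hu : ∀ i, Step p q k c (u i) (u (i + 1)))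
    (hu' : ∀ i, Step p q k c' (u' i) (u' (i + 1))) (hux : ∀ i, ‖u i - x i‖ < ε)
    (hux' : ∀ i, ‖u' i - x i‖ < ε) (i : ℕ) :
    m * ‖u i - u' i‖ ≤ B * ‖c - c'‖ / (1 - l) := by
  have hμ : ∀ i, m ≤ μ (x i) ∧ μ (x i) ≤ M := fun i => h.bounds _ (hx.1 i)
  refine (mul_le_mul_of_nonneg_right (hμ i).1 (norm_nonneg _)).trans
    (le_of_le_mul_succ_add (d := fun i => μ (x i) * ‖u i - u' i‖) (R := M * (ε + ε))
      h.l_nonneg h.l_lt (fun i => ?_) (fun i => ?_) i)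
  · exact h.contraction _ (hx.1 i) _ (hx.1 (i + 1)) (hx.2 i) c c' _ _ _ _ hc hc' (hux i) (hux' i)
      (hux _) (hux' _) (hu i) (hu' i)
  · have h1 : ‖u i - u' i‖ ≤ ε + ε := by
      calc ‖u i - u' i‖ = ‖(u i - x i) - (u' i - x i)‖ := by ring_nf
        _ ≤ ‖u i - x i‖ + ‖u' i - x i‖ := norm_sub_le _ _
        _ ≤ ε + ε := add_le_add (hux i).le (hux' i).le
    have h2 := h.m_pos
    have := hμ i
    exact mul_le_mul this.2 h1 (norm_nonneg _) (by linarith)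

theorem IsContracting.shadow_unique (h : IsContracting p q k c₀ Λ μ m M B l ε) {x : ℕ → ℂ}
    (hx : x ∈ orbits p q k c₀ Λ) {c : ℂ} (hc : ‖c - c₀‖ < ε)
    {u u' : ℕ → ℂ} (hu : ∀ i, Step p q k c (u i) (u (i + 1)))
    (hu' : ∀ i, Step p q k c (u' i) (u' (i + 1))) (hux : ∀ i, ‖u i - x i‖ < ε)
    (hux' : ∀ i, ‖u' i - x i‖ < ε) : u = u' := by
  funext i
  have h1 := h.dist_shadows_le hx hc hc hu hu' hux hux' i
  rw [sub_self, norm_zero, mul_zero, zero_div] at h1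
  have h2 : ‖u i - u' i‖ ≤ 0 := by
    by_contra h3
    exact absurd h1 (not_le.2 (mul_pos h.m_pos (not_le.1 h3)))
  exact sub_eq_zero.1 (norm_le_zero_iff.1 h2)

/-! ### Uniqueness of the motion -/

/-- The uniform Lipschitz constant makes the neighbourhood independent of `x`. It therefore works
for all shifts of an orbit at once, as shadowing requires. -/
theorem IsOrbitMotion.eventually_norm_sub_lt {U : Set ℂ} {w : ℂ → (ℕ → ℂ) → ℂ}
    (hw : IsOrbitMotion p q k c₀ Λ U w) {c₁ : ℂ} (hc₁ : c₁ ∈ U) (hε : 0 < ε) :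
    ∀ᶠ c in 𝓝 c₁, c ∈ U ∧ ∀ x ∈ orbits p q k c₀ Λ, ‖w c x - w c₁ x‖ < ε := by
  obtain ⟨C, hC, hL⟩ := hw.lipschitz
  filter_upwards [hw.isOpen.mem_nhds hc₁, ball_mem_nhds c₁ (show 0 < ε / C by positivity)]
    with c hc hc'
  refine ⟨hc, fun x hx => (hL c hc c₁ hc₁ x hx).trans_lt ?_⟩
  rwa [mem_ball, dist_eq_norm, lt_div_iff₀' hC] at hc'

/-- Two motions of the orbits in `Λ` agree on every connected set of parameters that contains the
base point. -/
theorem IsOrbitMotion.unique {U U' W : Set ℂ} {w w' : ℂ → (ℕ → ℂ) → ℂ} (hq : 2 ≤ q)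
    (hpq : q < p) (hw : IsOrbitMotion p q k c₀ Λ U w) (hw' : IsOrbitMotion p q k c₀ Λ U' w')
    (hW : IsConnected W) (h0 : c₀ ∈ W) (hWU : W ⊆ U ∩ U') {c : ℂ} (hc : c ∈ W) {x : ℕ → ℂ}
    (hx : x ∈ orbits p q k c₀ Λ) : w c x = w' c x := by
  let agree : ℂ → Prop := fun c => ∀ x ∈ orbits p q k c₀ Λ, w c x = w' c x
  have hloc : ∀ c₁ ∈ W, ∀ᶠ c in 𝓝[W] c₁, agree c₁ ↔ agree c := by
    intro c₁ hc₁
    refine Filter.Eventually.filter_mono nhdsWithin_le_nhds ?_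
    have hU := (hWU hc₁).1
    have hU' := (hWU hc₁).2
    by_cases hag : agree c₁
    -- When the motions agree at `c₁`, both moved orbits at a nearby `c` shadow the same orbit of
    -- the hyperbolic set at `c₁`, so they coincide.
    · obtain ⟨μ, m, M, B, l, ε, hcon⟩ := (hw.hyperbolic c₁ hU).exists_isContracting hq hpq
      filter_upwards [hw.eventually_norm_sub_lt hU hcon.ε_pos,
        hw'.eventually_norm_sub_lt hU' hcon.ε_pos, ball_mem_nhds c₁ hcon.ε_pos] with c h1 h2 h3
      refine iff_of_true hag fun x hx => ?_
      rw [mem_ball, dist_eq_norm] at h3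
      have h4 := hcon.shadow_unique (hw.trace_mem hU hx) h3 (u := trace w c x)
        (u' := trace w' c x) (hw.trace_mem h1.1 hx).2 (hw'.trace_mem h2.1 hx).2
        (fun i => h1.2 _ (tail_mem_orbits hx i)) fun i => by
          have h5 := h2.2 _ (tail_mem_orbits hx i)
          rwa [← hag _ (tail_mem_orbits hx i)] at h5
      exact congrFun h4 0
    · obtain ⟨x, hx, hne⟩ : ∃ x ∈ orbits p q k c₀ Λ, w c₁ x ≠ w' c₁ x := by
        by_contra hcon
        push Not at hcon
        exact hag hcon
      have h1 := ((hw.holomorphic x hx).continuousOn.continuousAt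
        (hw.isOpen.mem_nhds hU))
      have h2 := ((hw'.holomorphic x hx).continuousOn.continuousAt
        (hw'.isOpen.mem_nhds hU'))
      filter_upwards [(h1.sub h2).eventually_ne (sub_ne_zero.2 hne)] with c hcne
      exact iff_of_false hag fun h => hcne (sub_eq_zero.2 (h x hx))
  have h1 := hW.isPreconnected.induction₂ (fun c c' => agree c ↔ agree c') hloc
    (fun _ _ _ _ _ _ h h' => h.trans h') (fun _ _ _ _ h => h.symm) h0 hc
  exact h1.1 (fun x hx => by rw [hw.base x hx, hw'.base x hx]) x hx

end PowerCorr

namespace PowerCorr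

/-! ### Existence of shadowing orbits -/

/-- The branch of the inverse of `Step p q k c` that takes `y` to `x` when `c = c₀`. -/
noncomputable def backBranch (p q : ℕ) (k : HypKind) (c₀ x y c v : ℂ) : ℂ :=
  k.lshift * c + (x - k.lshift * c₀) *
    ((v - k.rshift * c) / (y - k.rshift * c₀)) ^ ((k.rexp p q : ℂ) / k.lexp p q)

/-- The `n`-th approximation to the orbit for the parameter `c` that shadows `x`. -/
noncomputable def shadowApprox (p q : ℕ) (k : HypKind) (c₀ : ℂ) (x : ℕ → ℂ) : ℕ → ℕ → ℂ → ℂ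
  | 0, i, _ => x i
  | n + 1, i, c => backBranch p q k c₀ (x i) (x (i + 1)) c (shadowApprox p q k c₀ x n (i + 1) c)

variable {p q : ℕ} {k : HypKind} {c₀ c : ℂ} {Λ : Set ℂ}

theorem step_backBranch (hq : 2 ≤ q) (hpq : q < p) {x y : ℂ} (h : Step p q k c₀ x y)
    (hy : y - k.rshift * c₀ ≠ 0) (c v : ℂ) : Step p q k c (backBranch p q k c₀ x y c v) v := by
  rw [step_iff] at h ⊢
  rw [backBranch, add_sub_cancel_left, mul_pow, cpow_div_natCast_pow _ _ (k.lexp_ne_zero hq hpq), h,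
    div_pow, mul_div_cancel₀ _ (pow_ne_zero _ hy)]

/-- The lower bound `κ` keeps the base of the power near `1`, uniformly in `y`, and hence off the
cut of the principal branch. The bound `R` on the prefactor makes the estimate uniform in `x`. -/
theorem exists_backBranch_near (p q : ℕ) (k : HypKind) (c₀ : ℂ) {ε κ R : ℝ} (hε : 0 < ε)
    (hκ : 0 < κ) (hR : 0 ≤ R) : ∃ ρ > 0, ∀ x y : ℂ, κ ≤ ‖y - k.rshift * c₀‖ →
      ‖x - k.lshift * c₀‖ ≤ R → ∀ c v : ℂ, ‖c - c₀‖ < ρ → ‖v - y‖ < ρ →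
        (v - k.rshift * c) / (y - k.rshift * c₀) ∈ Complex.slitPlane ∧
          ‖backBranch p q k c₀ x y c v - x‖ < ε := by
  set θ : ℂ := (k.rexp p q : ℂ) / k.lexp p q with hθ
  have h1 : ∀ᶠ ζ in 𝓝 (1 : ℂ), ζ ∈ Complex.slitPlane ∧ ‖ζ ^ θ - 1‖ < ε / (2 * (R + 1)) := by
    have hcont : ContinuousAt (fun ζ : ℂ => ‖ζ ^ θ - 1‖) 1 :=
      ((continuousAt_id.cpow continuousAt_const (by simp)).sub continuousAt_const).norm
    refine (Complex.isOpen_slitPlane.eventually_mem (by simp)).and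
      (hcont.eventually_mem (Iio_mem_nhds ?_))
    simp only [Complex.one_cpow, sub_self, norm_zero]
    positivity
  obtain ⟨η, hη, hηs⟩ := Metric.eventually_nhds_iff.1 h1
  refine ⟨min (η * κ / 2) (ε / 2), by positivity, fun x y hy hx c v hc hv => ?_⟩
  have hc1 := hc.trans_le (min_le_left _ _)
  have hc2 := hc.trans_le (min_le_right _ _)
  have hv1 := hv.trans_le (min_le_left _ _)
  have hy0 : 0 < ‖y - k.rshift * c₀‖ := hκ.trans_le hy
  have hdist : dist ((v - k.rshift * c) / (y - k.rshift * c₀)) 1 < η := by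
    rw [dist_eq_norm, div_sub_one (norm_pos_iff.1 hy0), norm_div, div_lt_iff₀ hy0]
    calc ‖v - k.rshift * c - (y - k.rshift * c₀)‖
        = ‖(v - y) - k.rshift * (c - c₀)‖ := by ring_nf
      _ ≤ ‖v - y‖ + ‖k.rshift * (c - c₀)‖ := norm_sub_le _ _
      _ ≤ ‖v - y‖ + 1 * ‖c - c₀‖ := by
          rw [norm_mul]
          gcongr
          exact k.norm_rshift_le
      _ < η * κ := by linarith
      _ ≤ η * ‖y - k.rshift * c₀‖ := by gcongr
  obtain ⟨h2, h3⟩ := hηs hdist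
  refine ⟨h2, ?_⟩
  set ζ := (v - k.rshift * c) / (y - k.rshift * c₀) with hζ
  calc ‖backBranch p q k c₀ x y c v - x‖
      = ‖k.lshift * (c - c₀) + (x - k.lshift * c₀) * (ζ ^ θ - 1)‖ := by
        rw [backBranch, ← hζ, ← hθ]
        ring_nf
    _ ≤ ‖k.lshift * (c - c₀)‖ + ‖(x - k.lshift * c₀) * (ζ ^ θ - 1)‖ := norm_add_le _ _
    _ ≤ 1 * ‖c - c₀‖ + R * (ε / (2 * (R + 1))) := by
        rw [norm_mul, norm_mul]
        gcongr
        exact k.norm_lshift_le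
    _ < ε / 2 + ε / 2 := by
        have h4 : R * (ε / (2 * (R + 1))) ≤ ε / 2 := by
          rw [mul_div_assoc', div_le_div_iff₀ (by positivity) (by positivity)]
          nlinarith
        linarith
    _ = ε := by ring

theorem isClosed_step (p q : ℕ) (k : HypKind) :
    IsClosed {z : ℂ × ℂ × ℂ | Step p q k z.1 z.2.1 z.2.2} := by
  simp only [step_iff]
  exact isClosed_eq (by fun_prop) (by fun_prop)

variable {μ : ℂ → ℝ} {m M B l ε κ R : ℝ}

/-- Every orbit in `Λ` is shadowed, for nearby parameters, by an orbit that depends holomorphically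
on the parameter. -/
theorem IsContracting.exists_shadow (hq : 2 ≤ q) (hpq : q < p)
    (h : IsContracting p q k c₀ Λ μ m M B l ε) (hκ : 0 < κ) (hR : 0 ≤ R)
    (hbd : ∀ x ∈ Λ, ∀ y ∈ Λ, Step p q k c₀ x y →
      κ ≤ ‖y - k.rshift * c₀‖ ∧ ‖x - k.lshift * c₀‖ ≤ R) {e : ℝ} (he : 0 < e) :
    ∃ ρ > 0, ∀ x ∈ orbits p q k c₀ Λ, ∃ w : ℕ → ℂ → ℂ,
      (∀ i, DifferentiableOn ℂ (w i) (ball c₀ ρ)) ∧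
      ∀ c ∈ ball c₀ ρ, (∀ i, Step p q k c (w i c) (w (i + 1) c)) ∧ ∀ i, ‖w i c - x i‖ < e := by
  have hm := h.m_pos
  have hB := h.B_pos
  have hε := h.ε_pos
  have hl : 0 < 1 - l := by linarith [h.l_lt]
  obtain ⟨ρ₁, hρ₁, hbr⟩ := exists_backBranch_near p q k c₀ hε hκ hR
  set τ : ℝ := min (min ρ₁ ε) e / 2 with hτ
  have hτ0 : 0 < τ := by positivity
  have hτ1 : τ < ρ₁ := by
    have : min (min ρ₁ ε) e ≤ ρ₁ := (min_le_left _ _).trans (min_le_left _ _)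
    linarith
  have hτ2 : τ < ε := by
    have : min (min ρ₁ ε) e ≤ ε := (min_le_left _ _).trans (min_le_right _ _)
    linarith
  have hτ3 : τ < e := by
    have : min (min ρ₁ ε) e ≤ e := min_le_right _ _
    linarith
  -- With `B * ‖c - c₀‖ ≤ (1 - l) * (m * τ)`, the weighted bound `m * τ` is preserved by pulling
  -- back: `l * (m * τ) + (1 - l) * (m * τ) = m * τ`.
  set ρ : ℝ := min (min ρ₁ ε) ((1 - l) * (m * τ) / B) with hρ
  have hρ0 : 0 < ρ := by positivity
  refine ⟨ρ, hρ0, fun x hx => ?_⟩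
  have hμ : ∀ i, m ≤ μ (x i) := fun i => (h.bounds _ (hx.1 i)).1
  have hμ0 : ∀ i, 0 < μ (x i) := fun i => hm.trans_le (hμ i)
  have hx0 : ∀ i, 0 < ‖x (i + 1) - k.rshift * c₀‖ := fun i =>
    hκ.trans_le (hbd _ (hx.1 i) _ (hx.1 (i + 1)) (hx.2 i)).1
  set W := shadowApprox p q k c₀ x with hW
  have hWs : ∀ n i c, W (n + 1) i c = backBranch p q k c₀ (x i) (x (i + 1)) c (W n (i + 1) c) :=
    fun n i c => rfl
  have hstep : ∀ n i c, Step p q k c (W (n + 1) i c) (W n (i + 1) c) := fun n i c =>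
    step_backBranch hq hpq (hx.2 i) (norm_pos_iff.1 (hx0 i)) _ _
  have hball : ∀ c ∈ ball c₀ ρ, ‖c - c₀‖ < ρ₁ ∧ ‖c - c₀‖ < ε ∧ B * ‖c - c₀‖ ≤ (1 - l) * (m * τ) := by
    intro c hc
    rw [mem_ball, dist_eq_norm] at hc
    refine ⟨hc.trans_le ((min_le_left _ _).trans (min_le_left _ _)),
      hc.trans_le ((min_le_left _ _).trans (min_le_right _ _)), ?_⟩
    have := (hc.trans_le (min_le_right _ _)).le
    rwa [le_div_iff₀' hB] at this
  have hclose : ∀ n i, ∀ c ∈ ball c₀ ρ, μ (x i) * ‖W n i c - x i‖ ≤ m * τ →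
      ‖W n i c - x i‖ ≤ τ := by
    intro n i c _ h1
    refine le_of_mul_le_mul_left (le_trans ?_ h1) hm
    gcongr
    exact hμ i
  have hA : ∀ n i, ∀ c ∈ ball c₀ ρ, μ (x i) * ‖W n i c - x i‖ ≤ m * τ := by
    intro n
    induction n with
    | zero =>
      intro i c _
      have : W 0 i c = x i := rfl
      rw [this, sub_self, norm_zero, mul_zero]
      positivity
    | succ n ih =>
      intro i c hc
      obtain ⟨hc1, hc2, hc3⟩ := hball c hc
      have h1 := hclose n (i + 1) c hc (ih (i + 1) c hc)
      have hb := hbd _ (hx.1 i) _ (hx.1 (i + 1)) (hx.2 i)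
      -- This crude bound only ensures that the contraction estimate applies; the estimate then
      -- returns the sharp bound.
      have h2 := (hbr (x i) (x (i + 1)) hb.1 hb.2 c (W n (i + 1) c) hc1 (h1.trans_lt hτ1)).2
      rw [← hWs] at h2
      have h3 := h.contraction _ (hx.1 i) _ (hx.1 (i + 1)) (hx.2 i) c c₀ _ _ _ _ hc2
        (by simpa using hε) h2 (by simpa using hε) (h1.trans_lt hτ2) (by simpa using hε)
        (hstep n i c) (hx.2 i)
      refine h3.trans ?_
      have h4 := mul_le_mul_of_nonneg_left (ih (i + 1) c hc) h.l_nonneg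
      linarith
  have hA' : ∀ n i, ∀ c ∈ ball c₀ ρ, ‖W n i c - x i‖ ≤ τ := fun n i c hc =>
    hclose n i c hc (hA n i c hc)
  have hgeom : ∀ n i, ∀ c ∈ ball c₀ ρ, μ (x i) * ‖W (n + 1) i c - W n i c‖ ≤ l ^ n * (m * τ) := by
    intro n
    induction n with
    | zero => intro i c hc; rw [pow_zero, one_mul]; exact hA 1 i c hc
    | succ n ih =>
      intro i c hc
      obtain ⟨-, hc2, -⟩ := hball c hc
      have h3 := h.contraction _ (hx.1 i) _ (hx.1 (i + 1)) (hx.2 i) c c _ _ _ _ hc2 hc2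
        ((hA' (n + 2) i c hc).trans_lt hτ2) ((hA' (n + 1) i c hc).trans_lt hτ2)
        ((hA' (n + 1) (i + 1) c hc).trans_lt hτ2) ((hA' n (i + 1) c hc).trans_lt hτ2)
        (hstep (n + 1) i c) (hstep n i c)
      rw [sub_self, norm_zero, mul_zero, add_zero] at h3
      refine h3.trans ?_
      rw [pow_succ', mul_assoc]
      exact mul_le_mul_of_nonneg_left (ih (i + 1) c hc) h.l_nonneg
  have hgeom' : ∀ i, ∀ c ∈ ball c₀ ρ, ∀ n, dist (W n i c) (W (n + 1) i c) ≤ τ * l ^ n := by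
    intro i c hc n
    rw [dist_comm, dist_eq_norm]
    refine le_of_mul_le_mul_left 
      (le_trans ?_ ((hgeom n i c hc).trans_eq (by ring : _ = m * (τ * l ^ n)))) hm
    gcongr
    exact hμ i
  have hdiff : ∀ n i, DifferentiableOn ℂ (W n i) (ball c₀ ρ) := by
    intro n
    induction n with
    | zero => intro i; exact differentiableOn_const _
    | succ n ih =>
      intro i c hc
      have hb := hbd _ (hx.1 i) _ (hx.1 (i + 1)) (hx.2 i)
      have h1 := (hbr (x i) (x (i + 1)) hb.1 hb.2 c (W n (i + 1) c) (hball c hc).1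
        ((hA' n (i + 1) c hc).trans_lt hτ1)).1
      have h2 := ih (i + 1) c hc
      have h3 : DifferentiableWithinAt ℂ
          (fun c => (W n (i + 1) c - k.rshift * c) / (x (i + 1) - k.rshift * c₀)) (ball c₀ ρ) c :=
        (h2.sub (differentiableWithinAt_id.const_mul _)).div_const _
      exact (differentiableWithinAt_id.const_mul _).add ((h3.cpow_const h1).const_mul _)
  have hlim : ∀ i c, ∃ b, c ∈ ball c₀ ρ → Tendsto (fun n => W n i c) atTop (𝓝 b) := by
    intro i c
    by_cases hc : c ∈ ball c₀ ρ
    · obtain ⟨b, hb⟩ := cauchySeq_tendsto_of_complete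
        (cauchySeq_of_le_geometric l τ h.l_lt (hgeom' i c hc))
      exact ⟨b, fun _ => hb⟩
    · exact ⟨0, fun h => absurd h hc⟩
  choose w hw using hlim
  refine ⟨w, fun i => ?_, fun c hc => ⟨fun i => ?_, fun i => ?_⟩⟩
  · have hunif : TendstoUniformlyOn (fun n => W n i) (w i) atTop (ball c₀ ρ) := by
      rw [Metric.tendstoUniformlyOn_iff]
      intro δ hδ
      have h1 : Tendsto (fun n => τ * l ^ n / (1 - l)) atTop (𝓝 0) := by
        simpa using ((tendsto_pow_atTop_nhds_zero_of_lt_one h.l_nonneg h.l_lt).const_mul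
          τ).div_const (1 - l)
      filter_upwards [h1.eventually_lt_const hδ] with n hn c hc
      rw [dist_comm]
      exact (dist_le_of_le_geometric_of_tendsto l τ h.l_lt (hgeom' i c hc) (hw i c hc) n).trans_lt hn
    exact hunif.tendstoLocallyUniformlyOn.differentiableOn
      (Eventually.of_forall fun n => hdiff n i) isOpen_ball
  · have h1 : Tendsto (fun n => (c, W (n + 1) i c, W n (i + 1) c)) atTop
        (𝓝 (c, w i c, w (i + 1) c)) :=
      tendsto_const_nhds.prodMk_nhds
        (((hw i c hc).comp (tendsto_add_atTop_nat 1)).prodMk_nhds (hw (i + 1) c hc))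
    exact (isClosed_step p q k).mem_of_tendsto h1 (Eventually.of_forall fun n => hstep n i c)
  · refine lt_of_le_of_lt (le_of_tendsto' ((hw i c hc).sub_const (x i)).norm fun n => ?_) hτ3
    exact hA' n i c hc

end PowerCorr

namespace PowerCorr

/-! ### Persistence of admissible scales -/

theorem isOpen_annulus (r : ℝ) : IsOpen (annulus r) :=
  (isOpen_lt continuous_const continuous_norm).inter (isOpen_lt continuous_norm continuous_const)

variable {p q : ℕ} {k : HypKind} {c₀ c : ℂ} {Λ : Set ℂ} {r δ : ℝ}

theorem IsBundleScale.ne_zero (h : IsBundleScale p q c Λ r δ) {z : ℂ} (hz : z ∈ Λ) : z ≠ 0 :=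
  norm_pos_iff.1 (h.r_pos.trans (h.subset_annulus z hz).1.1)

theorem disjoint_disks_iff {w w' : ℂ} (hr : 0 ≤ r) (hδ : 0 ≤ δ) :
    Disjoint (closedBall ((r : ℂ) * w) δ) (closedBall ((r : ℂ) * w') δ) ↔
      2 * δ < r * ‖w - w'‖ := by
  rw [disjoint_closedBall_closedBall_iff hδ hδ, dist_eq_norm, ← mul_sub, norm_mul,
    Complex.norm_real, Real.norm_of_nonneg hr, two_mul]

theorem eventually_annulus (h : IsBundleScale p q c₀ Λ r δ) (hΛ : IsCompact Λ) :
    ∃ ε > 0, ∀ c z x : ℂ, x ∈ Λ → ‖c - c₀‖ < ε → ‖z - x‖ < ε →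
      z ∈ annulus r ∧ z - c ∈ annulus r := by
  obtain ⟨ε, hε, hO⟩ := (isCompact_singleton (x := c₀) |>.prod hΛ).exists_thickening_subset_open
    (t := {y : ℂ × ℂ | y.2 ∈ annulus r ∧ y.2 - y.1 ∈ annulus r})
    (((isOpen_annulus r).preimage continuous_snd).inter
      ((isOpen_annulus r).preimage (continuous_snd.sub continuous_fst)))
    (by rintro ⟨_, z⟩ ⟨rfl, hz⟩; exact h.subset_annulus z hz)
  refine ⟨ε, hε, fun c z x hx hc hz => ?_⟩
  refine hO (a := (c, z)) (mem_thickening_iff.2 ⟨(c₀, x), ⟨rfl, hx⟩, ?_⟩)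
  rw [Prod.dist_eq, max_lt_iff, dist_eq_norm, dist_eq_norm]
  exact ⟨hc, hz⟩

/-- Distinct images of a nearby point could be close to the same point of `Λ`, so openness of
disjointness alone is not enough. Each triple in `Λ` lies in one of three open sets: `z, w` is not a
step, `geomSum` is nonzero, or the disks are disjoint. The second covers `w = w'`, since powers have
nonzero derivative there, and nearby it forbids distinct images of one point. -/
theorem eventually_disjoint_disks (hq : 2 ≤ q) (hpq : q < p) (h : IsBundleScale p q c₀ Λ r δ)
    (hΛ : IsCompact Λ) (k : HypKind) :
    ∃ ε > 0, ∀ c z w w' x y y' : ℂ, x ∈ Λ → y ∈ Λ → y' ∈ Λ → ‖c - c₀‖ < ε → ‖z - x‖ < ε →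
      ‖w - y‖ < ε → ‖w' - y'‖ < ε → Step p q k c z w → Step p q k c z w' → w ≠ w' →
      Disjoint (closedBall ((r : ℂ) * w) δ) (closedBall ((r : ℂ) * w') δ) := by
  set t := k.rshift with ht
  set b := k.rexp p q with hb
  have hG : Continuous fun y : ℂ × ℂ × ℂ × ℂ => geomSum b (y.2.2.1 - t * y.1) (y.2.2.2 - t * y.1) :=
    (continuous_geomSum b).comp (by fun_prop :
      Continuous fun y : ℂ × ℂ × ℂ × ℂ => (y.2.2.1 - t * y.1, y.2.2.2 - t * y.1))
  have hS : IsOpen {y : ℂ × ℂ × ℂ × ℂ | Step p q k y.1 y.2.1 y.2.2.1}ᶜ :=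
    ((isClosed_step p q k).preimage (by fun_prop :
      Continuous fun y : ℂ × ℂ × ℂ × ℂ => (y.1, y.2.1, y.2.2.1))).isOpen_compl
  have hD : IsOpen {y : ℂ × ℂ × ℂ × ℂ | 2 * δ < r * ‖y.2.2.1 - y.2.2.2‖} :=
    isOpen_lt (by fun_prop) (by fun_prop)
  obtain ⟨ε, hε, hO⟩ := (isCompact_singleton (x := c₀) |>.prod
    (hΛ.prod (hΛ.prod hΛ))).exists_thickening_subset_open
    ((hS.union (isOpen_compl_singleton.preimage hG (t := {0}ᶜ))).union hD) (by
      rintro ⟨c₁, z, w, w'⟩ ⟨hc₁, hz, hw, hw'⟩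
      obtain rfl : c₀ = c₁ := (mem_singleton_iff.1 hc₁).symm
      by_contra hcon
      simp only [mem_union, not_or, mem_compl_iff, not_not, mem_preimage, mem_singleton_iff,
        mem_ofPred_eq] at hcon
      obtain ⟨⟨h1, h2⟩, h3⟩ := hcon
      have h4 : (w - t * c₀) ^ b = (w' - t * c₀) ^ b := by
        rw [← sub_eq_zero, ← geomSum_mul, h2, zero_mul]
      have h5 : Step p q k c₀ z w' := by
        rw [step_iff] at h1 ⊢
        exact h1.trans h4
      have h6 : w ≠ w' := by
        rintro rfl
        rw [geomSum_self] at h2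
        have h7 := h1.right_ne_zero hq (h.ne_zero hz) (h.ne_zero hw)
        exact mul_ne_zero (by exact_mod_cast k.rexp_ne_zero hq hpq) (pow_ne_zero _ h7) h2
      exact h3 ((disjoint_disks_iff h.r_pos.le h.δ_pos.le).1
        (h.disjoint_disks k z hz w hw w' hw' h1 h5 h6)))
  refine ⟨ε, hε, fun c z w w' x y y' hx hy hy' hc hz hw hw' h1 h2 hne => ?_⟩
  have hmem := hO (mem_thickening_iff.2 ⟨(c₀, x, y, y'), ⟨rfl, hx, hy, hy'⟩,
    show dist (c, z, w, w') _ < ε by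
      simp only [Prod.dist_eq, max_lt_iff]
      simp only [dist_eq_norm]
      exact ⟨hc, hz, hw, hw'⟩⟩)
  rw [disjoint_disks_iff h.r_pos.le h.δ_pos.le]
  rcases hmem with (hmem | hmem) | hmem
  · exact absurd h1 hmem
  · refine absurd ?_ hmem
    rw [step_iff] at h1 h2
    refine (mul_eq_zero.1 ?_).resolve_right (sub_ne_zero.2 hne)
    have h3 := geomSum_mul b (w - t * c) (w' - t * c)
    rw [← h1, ← h2, sub_self] at h3
    rwa [sub_sub_sub_cancel_right] at h3
  · exact hmem

theorem eventually_disks_subset (h : IsBundleScale p q c₀ Λ r δ)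
    (hΛ : IsCompact Λ) (k : HypKind) :
    ∃ ε > 0, ∀ c z w x y : ℂ, x ∈ Λ → y ∈ Λ → ‖c - c₀‖ < ε → ‖z - x‖ < ε →
      ‖w - y‖ < ε → Step p q k c z w → closedBall ((r : ℂ) * w) δ ⊆ ball 0 1 := by
  have hD : IsOpen {y : ℂ × ℂ × ℂ | r * ‖y.2.2‖ + δ < 1} :=
    isOpen_lt (by fun_prop) (by fun_prop)
  obtain ⟨ε, hε, hO⟩ := (isCompact_singleton (x := c₀) |>.prod
    (hΛ.prod hΛ)).exists_thickening_subset_open ((isClosed_step p q k).isOpen_compl.union hD) (by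
      rintro ⟨c₁, z, w⟩ ⟨hc₁, hz, hw⟩
      obtain rfl : c₀ = c₁ := (mem_singleton_iff.1 hc₁).symm
      by_cases hs : Step p q k c₀ z w
      · exact Or.inr (h.norm_step hz hw hs)
      · exact Or.inl hs)
  refine ⟨ε, hε, fun c z w x y hx hy hc hz hw h1 => ?_⟩
  have hmem := hO (mem_thickening_iff.2 ⟨(c₀, x, y), ⟨rfl, hx, hy⟩,
    show dist (c, z, w) _ < ε by
      simp only [Prod.dist_eq, max_lt_iff]
      simp only [dist_eq_norm]
      exact ⟨hc, hz, hw⟩⟩)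
  have h2 : r * ‖w‖ + δ < 1 := hmem.resolve_left (fun h => h h1)
  refine closedBall_subset_ball' ?_
  rw [dist_zero_right, norm_mul, Complex.norm_real, Real.norm_of_nonneg h.r_pos.le]
  linarith

/-- An admissible scale remains admissible for all sets close to `Λ` and parameters close to
`c₀`. -/
theorem IsBundleScale.persists (hq : 2 ≤ q) (hpq : q < p) (h : IsBundleScale p q c₀ Λ r δ)
    (hΛ : IsCompact Λ) : ∃ ε > 0, ∀ c : ℂ, ‖c - c₀‖ < ε → ∀ Λ' : Set ℂ,
      (∀ z ∈ Λ', ∃ x ∈ Λ, ‖z - x‖ < ε) → IsBundleScale p q c Λ' r δ := by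
  obtain ⟨ε₁, hε₁, h₁⟩ := eventually_annulus h hΛ
  have h₂ := eventually_disjoint_disks hq hpq h hΛ
  have h₃ := fun k => eventually_disks_subset (k := k) h hΛ
  choose ε₂ hε₂ h₂ using h₂
  choose ε₃ hε₃ h₃ using h₃
  obtain ⟨ε₄, hε₄, h₄⟩ : ∃ ε > 0, ∀ c : ℂ, ‖c - c₀‖ < ε → 4 * ‖c‖ * r < 1 := by
    have h5 : Continuous fun c : ℂ => 4 * ‖c‖ * r := by fun_prop
    obtain ⟨ε, hε, h6⟩ := Metric.eventually_nhds_iff.1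
      ((h5.tendsto c₀).eventually_lt_const h.r_mul_lt)
    exact ⟨ε, hε, fun c hc => h6 (by rwa [dist_eq_norm])⟩
  have hk : ∃ ε > 0, ∀ k, ε ≤ ε₂ k ∧ ε ≤ ε₃ k := by
    refine ⟨min (min (ε₂ .expanding) (ε₂ .attracting)) (min (ε₃ .expanding) (ε₃ .attracting)),
      lt_min (lt_min (hε₂ _) (hε₂ _)) (lt_min (hε₃ _) (hε₃ _)), ?_⟩
    rintro (_ | _) <;> simp
  obtain ⟨ε₅, hε₅, hk⟩ := hk
  refine ⟨min (min ε₁ ε₄) ε₅, by positivity, fun c hc Λ' hΛ' => ?_⟩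
  have hle₁ : min (min ε₁ ε₄) ε₅ ≤ ε₁ := (min_le_left _ _).trans (min_le_left _ _)
  have hle₄ : min (min ε₁ ε₄) ε₅ ≤ ε₄ := (min_le_left _ _).trans (min_le_right _ _)
  have hle₂ : ∀ k, min (min ε₁ ε₄) ε₅ ≤ ε₂ k := fun k => (min_le_right _ _).trans (hk k).1
  have hle₃ : ∀ k, min (min ε₁ ε₄) ε₅ ≤ ε₃ k := fun k => (min_le_right _ _).trans (hk k).2
  choose! x hx hzx using hΛ'
  refine ⟨h.r_pos, h.r_lt, h₄ c (hc.trans_le hle₄), h.δ_pos, ?_, ?_, ?_⟩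
  · exact fun z hz => h₁ c z _ (hx z hz) (hc.trans_le hle₁) ((hzx z hz).trans_le hle₁)
  · exact fun k z hz w hw w' hw' => h₂ k c z w w' _ _ _ (hx z hz) (hx w hw) (hx w' hw')
      (hc.trans_le (hle₂ k)) ((hzx z hz).trans_le (hle₂ k)) ((hzx w hw).trans_le (hle₂ k))
      ((hzx w' hw').trans_le (hle₂ k))
  · exact fun k z hz w hw => h₃ k c z w _ _ (hx z hz) (hx w hw)
      (hc.trans_le (hle₃ k)) ((hzx z hz).trans_le (hle₃ k)) ((hzx w hw).trans_le (hle₃ k))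

/-! ### Persistence of hyperbolic metrics -/

/-- In a connected open set, every compact subset lies in a connected compact subset. -/
theorem exists_isCompact_isConnected_between {V : Set ℂ} (hV : IsOpen V) (hVc : IsConnected V)
    (hΛ : IsCompact Λ) (hΛV : Λ ⊆ V) :
    ∃ K, IsCompact K ∧ IsConnected K ∧ Λ ⊆ K ∧ K ⊆ V := by
  obtain ⟨b, hb⟩ := hVc.nonempty
  have hpath : IsPathConnected V := hV.isConnected_iff_isPathConnected.1 hVc
  suffices h : ∃ K, IsCompact K ∧ (b ∈ K ∧ IsPreconnected K) ∧ Λ ⊆ K ∧ K ⊆ V by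
    obtain ⟨K, h1, h2, h3⟩ := h
    exact ⟨K, h1, ⟨⟨b, h2.1⟩, h2.2⟩, h3⟩
  refine hΛ.induction_on
    (p := fun s => ∃ K, IsCompact K ∧ (b ∈ K ∧ IsPreconnected K) ∧ s ⊆ K ∧ K ⊆ V) ?_ ?_ ?_ ?_
  · exact ⟨{b}, isCompact_singleton, ⟨rfl, isPreconnected_singleton⟩, empty_subset _,
      singleton_subset_iff.2 hb⟩
  · rintro s t hst ⟨K, h1, h2, h3, h4⟩
    exact ⟨K, h1, h2, hst.trans h3, h4⟩
  · rintro s t ⟨K, h1, h2, h3, h4⟩ ⟨K', h1', h2', h3', h4'⟩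
    exact ⟨K ∪ K', h1.union h1', ⟨Or.inl h2.1, h2.2.union b h2.1 h2'.1 h2'.2⟩,
      union_subset_union h3 h3', union_subset h4 h4'⟩
  · intro x hx
    obtain ⟨η, hη, hηV⟩ := nhds_basis_closedBall.mem_iff.1 (hV.mem_nhds (hΛV hx))
    obtain ⟨γ, hγ⟩ := hpath.joinedIn b hb x (hΛV hx)
    refine ⟨closedBall x η, mem_nhdsWithin_of_mem_nhds (closedBall_mem_nhds x hη),
      range γ ∪ closedBall x η, (isCompact_range γ.continuous).union (isCompact_closedBall x η),
      ⟨Or.inl ⟨0, γ.source⟩, ?_⟩, subset_union_right, union_subset (range_subset_iff.2 hγ) hηV⟩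
    exact (isPreconnected_range γ.continuous).union x ⟨1, γ.target⟩
      (mem_closedBall_self hη.le) (convex_closedBall x η).isPreconnected

/-- Each ball about a point of `K` meets the connected set `K`. This supplies the connected region
required in the definition of hyperbolicity. -/
theorem isConnected_thickening {K : Set ℂ} (hK : IsConnected K) {η : ℝ} (hη : 0 < η) :
    IsConnected (thickening η K) := by
  obtain ⟨b, hb⟩ := hK.nonempty
  refine ⟨⟨b, self_subset_thickening hη K hb⟩, isPreconnected_of_forall b fun y hy => ?_⟩
  obtain ⟨x, hx, hxy⟩ := mem_thickening_iff.1 hy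
  exact ⟨K ∪ ball x η, union_subset (self_subset_thickening hη K)
    (ball_subset_thickening hx η), Or.inl hb, Or.inr hxy,
    hK.isPreconnected.union x hx (mem_ball_self hη) (convex_ball x η).isPreconnected⟩

/-- Raising `l` to `l'` makes the inequality strict on the related pairs in the compact set `L`.
Being related is a closed condition, so a tube around `{c₀} × L × L` handles unrelated and related
pairs alike. -/
theorem HasHypFactor.persists {V L : Set ℂ} {μ : ℂ → ℝ} {l l' : ℝ} (hq : 2 ≤ q) (hpq : q < p)
    (h : HasHypFactor p q c₀ V μ l k) (hl : l < l') (hl0 : 0 < l) (hV : IsOpen V)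
    (hc : ContinuousOn μ V) (hμ : ∀ z ∈ V, 0 < μ z) (hL : IsCompact L) (hLV : L ⊆ V) :
    ∃ ε > 0, ∀ c : ℂ, ‖c - c₀‖ < ε → HasHypFactor p q c L μ l' k := by
  have hVV : IsOpen {y : ℂ × ℂ × ℂ | y.2.1 ∈ V ∧ y.2.2 ∈ V} :=
    (hV.preimage (continuous_fst.comp continuous_snd)).inter
      (hV.preimage (continuous_snd.comp continuous_snd))
  have h1 : ContinuousOn (fun y : ℂ × ℂ × ℂ => μ y.2.1) {y | y.2.1 ∈ V ∧ y.2.2 ∈ V} :=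
    hc.comp (continuous_fst.comp continuous_snd).continuousOn fun z hz => hz.1
  have h2 : ContinuousOn (fun y : ℂ × ℂ × ℂ => expansion p q y.2.1 * μ y.2.2)
      {y | y.2.1 ∈ V ∧ y.2.2 ∈ V} :=
    ((continuous_expansion hq hpq).comp (continuous_fst.comp continuous_snd)).continuousOn.mul
      (hc.comp (continuous_snd.comp continuous_snd).continuousOn fun z hz => hz.2)
  have hR : IsOpen {y : ℂ × ℂ × ℂ | CorrRel p q y.1 y.2.1 y.2.2}ᶜ :=
    (isClosed_step p q .expanding).isOpen_compl
  have tube : ∀ g : ℂ × ℂ × ℂ → ℝ, ContinuousOn g {y | y.2.1 ∈ V ∧ y.2.2 ∈ V} →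
      (∀ z ∈ V, ∀ w ∈ V, CorrRel p q c₀ z w → 0 < g (c₀, z, w)) →
      ∃ ε > 0, ∀ c : ℂ, ‖c - c₀‖ < ε → ∀ z ∈ L, ∀ w ∈ L, CorrRel p q c z w → 0 < g (c, z, w) := by
    intro g hg hpos
    obtain ⟨ε, hε, hO⟩ := (isCompact_singleton (x := c₀) |>.prod
      (hL.prod hL)).exists_thickening_subset_open
      (hR.union (hg.isOpen_inter_preimage hVV isOpen_Ioi (t := Ioi 0))) (by
        rintro ⟨c₁, z, w⟩ ⟨hc₁, hz, hw⟩
        obtain rfl : c₀ = c₁ := (mem_singleton_iff.1 hc₁).symm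
        by_cases hs : CorrRel p q c₀ z w
        · exact Or.inr ⟨⟨hLV hz, hLV hw⟩, hpos z (hLV hz) w (hLV hw) hs⟩
        · exact Or.inl hs)
    refine ⟨ε, hε, fun c hc z hz w hw hr => ?_⟩
    have hmem := hO (mem_thickening_iff.2 ⟨(c₀, z, w), ⟨rfl, hz, hw⟩,
      show dist (c, z, w) _ < ε by
        simp only [Prod.dist_eq, max_lt_iff, dist_self]
        exact ⟨by rwa [dist_eq_norm], hε⟩⟩)
    exact (hmem.resolve_left fun h => h hr).2
  cases k with
  | expanding =>
    obtain ⟨ε, hε, H⟩ := tube _ ((h2.const_mul l').sub h1) fun z hz w hw hr => by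
      have h3 := h z hz w hw hr
      have h4 := hμ z hz
      have h5 : 0 < expansion p q z * μ w := by
        by_contra h6
        nlinarith
      refine sub_pos.2 (h3.trans_lt ?_)
      exact mul_lt_mul_of_pos_right hl h5
    exact ⟨ε, hε, fun c hc z hz w hw hr => (sub_pos.1 (H c hc z hz w hw hr)).le⟩
  | attracting =>
    obtain ⟨ε, hε, H⟩ := tube _ ((h1.const_mul l').sub h2) fun z hz w hw hr => by
      have h3 := h z hz w hw hr
      refine sub_pos.2 (h3.trans_lt ?_)
      exact mul_lt_mul_of_pos_right hl (hμ z hz)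
    exact ⟨ε, hε, fun c hc z hz w hw hr => (sub_pos.1 (H c hc z hz w hw hr)).le⟩

/-- The metric is kept and the region shrunk to a thickening of a connected compact set containing
`Λ`. Its closed thickening is a compact subset of `V`, where the contraction factor persists. -/
theorem IsHyperbolicSet.persists (hq : 2 ≤ q) (hpq : q < p) (h : IsHyperbolicSet p q k c₀ Λ) :
    ∃ ε > 0, ∀ c : ℂ, ‖c - c₀‖ < ε → ∀ Λ' : Set ℂ, (∀ z ∈ Λ', ∃ x ∈ Λ, ‖z - x‖ < ε) →
      IsSemiInvariant p q c Λ' → IsHyperbolicSet p q k c Λ' := by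
  obtain ⟨hΛ, V, μ, hV, hVc, hΛV, hc, hμ, hm⟩ := h
  obtain ⟨l, hl0, hl1, hf⟩ := hm.exists_hasHypFactor hq hpq hV hc hμ
  obtain ⟨K, hK, hKc, hΛK, hKV⟩ := exists_isCompact_isConnected_between hV hVc hΛ.compact hΛV
  obtain ⟨η, hη, hηV⟩ := hK.exists_cthickening_subset_open hV hKV
  obtain ⟨ε, hε, H⟩ := hf.persists (l' := (1 + l) / 2) hq hpq (by linarith) hl0 hV hc hμ
    hK.cthickening hηV
  have hsub : thickening η K ⊆ cthickening η K := thickening_subset_cthickening η K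
  refine ⟨min ε η, by positivity, fun c hcε Λ' hΛ' hinv => ⟨hinv, thickening η K, μ,
    isOpen_thickening, isConnected_thickening hKc hη, fun z hz => ?_,
    hc.mono (hsub.trans hηV), fun z hz => hμ z (hηV (hsub hz)), ?_⟩⟩
  · obtain ⟨x, hx, hzx⟩ := hΛ' z hz
    refine mem_thickening_iff.2 ⟨x, hΛK hx, ?_⟩
    rw [dist_eq_norm]
    exact hzx.trans_le (min_le_right _ _)
  · refine HasHypFactor.isHyperbolicMetric (l := (1 + l) / 2) hq hpq (by linarith) (by linarith)
      (fun z hz => hμ z (hηV (hsub hz))) ?_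
    have h1 := H c (hcε.trans_le (min_le_left _ _))
    cases k with
    | expanding => exact fun z hz w hw => h1 z (hsub hz) w (hsub hw)
    | attracting => exact fun z hz w hw => h1 z (hsub hz) w (hsub hw)

/-! ### Existence of the motion -/

theorem isCompact_orbits (hΛ : IsCompact Λ) (k : HypKind) (c : ℂ) :
    IsCompact (orbits p q k c Λ) := by
  have h : orbits p q k c Λ = Set.pi univ (fun _ : ℕ => Λ) ∩
      ⋂ i, {x : ℕ → ℂ | Step p q k c (x i) (x (i + 1))} := by
    ext x
    simp [orbits]
  rw [h]
  refine (isCompact_univ_pi fun _ => hΛ).inter_right (isClosed_iInter fun i => ?_)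
  exact (isClosed_step p q k).preimage (by fun_prop :
    Continuous fun x : ℕ → ℂ => (c, x i, x (i + 1)))

/-- The initial points of the orbits for the parameter `c` that shadow an orbit in `Λ` form a compact
set. -/
theorem isCompact_shadows (hΛ : IsCompact Λ) (k : HypKind) (c₀ c : ℂ) (e : ℝ) :
    IsCompact {z : ℂ | ∃ x ∈ orbits p q k c₀ Λ, ∃ u : ℕ → ℂ, (∀ i, ‖u i - x i‖ ≤ e) ∧
      (∀ i, Step p q k c (u i) (u (i + 1))) ∧ u 0 = z} := by
  obtain ⟨R, hR⟩ := hΛ.isBounded.exists_norm_le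
  have hT : IsCompact ((orbits p q k c₀ Λ ×ˢ Set.pi univ fun _ : ℕ => closedBall (0 : ℂ) (e + R)) ∩
      ⋂ i, ({y : (ℕ → ℂ) × (ℕ → ℂ) | ‖y.2 i - y.1 i‖ ≤ e} ∩
        {y | Step p q k c (y.2 i) (y.2 (i + 1))})) := by
    refine ((isCompact_orbits hΛ k c₀).prod (isCompact_univ_pi fun _ =>
      isCompact_closedBall _ _)).inter_right (isClosed_iInter fun i => IsClosed.inter ?_ ?_)
    · exact isClosed_le (by fun_prop) continuous_const
    · exact (isClosed_step p q k).preimage (by fun_prop :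
        Continuous fun y : (ℕ → ℂ) × (ℕ → ℂ) => (c, y.2 i, y.2 (i + 1)))
  convert hT.image (f := fun y => y.2 0) (by fun_prop) using 1
  ext z
  constructor
  · rintro ⟨x, hx, u, h1, h2, rfl⟩
    refine ⟨(x, u), ⟨⟨hx, fun i _ => ?_⟩, mem_iInter.2 fun i => ⟨h1 i, h2 i⟩⟩, rfl⟩
    rw [mem_closedBall_zero_iff]
    calc ‖u i‖ = ‖(u i - x i) + x i‖ := by rw [sub_add_cancel]
      _ ≤ ‖u i - x i‖ + ‖x i‖ := norm_add_le _ _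
      _ ≤ e + R := add_le_add (h1 i) (hR _ (hx.1 i))
  · rintro ⟨⟨x, u⟩, ⟨⟨hx, -⟩, h1⟩, rfl⟩
    exact ⟨x, hx, u, fun i => (mem_iInter.1 h1 i).1, fun i => (mem_iInter.1 h1 i).2, rfl⟩

/-- Surjectivity of the shift provides the predecessors needed for semi-invariance of the moved set.
-/
theorem exists_orbit_extension (hΛ : IsSemiInvariant p q c Λ) {x : ℕ → ℂ}
    (hx : x ∈ orbits p q k c Λ) : ∃ y ∈ orbits p q k c Λ, tail 1 y = x := by
  obtain ⟨z, hz, hs⟩ := exists_step_from hΛ k (hx.1 0)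
  refine ⟨fun i => Nat.casesOn i z x, ⟨fun i => ?_, fun i => ?_⟩, rfl⟩
  · cases i with
    | zero => exact hz
    | succ i => exact hx.1 i
  · cases i with
    | zero => exact hs
    | succ i => exact hx.2 i

theorem isSemiInvariant_of_steps {Λ' : Set ℂ} (hne : Λ'.Nonempty) (hc : IsCompact Λ')
    (h0 : (0 : ℂ) ∉ Λ') (h1 : ∀ z ∈ Λ', ∃ w ∈ Λ', Step p q k c z w)
    (h2 : ∀ z ∈ Λ', ∃ w ∈ Λ', Step p q k c w z) : IsSemiInvariant p q c Λ' := by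
  cases k with
  | expanding => exact ⟨hne, hc, h0, h1, h2⟩
  | attracting => exact ⟨hne, hc, h0, h2, h1⟩

/-- The motion sends an orbit to the initial point of its shadow. Uniqueness of shadows yields
compatibility with the shift, the base condition, injectivity and compactness of the moved sets. -/
theorem IsHyperbolicSet.exists_isOrbitMotion (hq : 2 ≤ q) (hpq : q < p)
    (hΛ : IsHyperbolicSet p q k c₀ Λ) (h : IsBundleScale p q c₀ Λ r δ) :
    ∃ (U : Set ℂ) (w : ℂ → (ℕ → ℂ) → ℂ), IsOrbitMotion p q k c₀ Λ U w ∧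
      ∀ c ∈ U, IsBundleScale p q c (w c '' orbits p q k c₀ Λ) r δ := by
  have hinv := hΛ.1
  obtain ⟨μ, m, M, B, l, ε, hcon⟩ := hΛ.exists_isContracting hq hpq
  obtain ⟨ε₁, hε₁, hscale⟩ := h.persists hq hpq hinv.compact
  obtain ⟨ε₂, hε₂, hhyp⟩ := hΛ.persists hq hpq
  have hε := hcon.ε_pos
  have hr := h.r_pos
  have hm := hcon.m_pos
  have hB := hcon.B_pos
  have hl : 0 < 1 - l := by linarith [hcon.l_lt]
  -- The half gives injectivity: orbits with a common shadow are then less than `ε` apart. The other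
  -- terms keep the moved set within reach of the persistence lemmas.
  set e := min (ε / 2) (min ε₁ ε₂) with he
  have he0 : 0 < e := by positivity
  have heε : e ≤ ε / 2 := min_le_left _ _
  -- The bounds `κ = r` and `R = 1 / (2 * r)` come from the annulus, applied to `z` or to `z - c₀`
  -- according to the type.
  obtain ⟨ρ, hρ, hsh⟩ := hcon.exists_shadow hq hpq hr
    (show 0 ≤ 1 / (2 * r) by positivity) (fun x hx y hy _ => by
      have h1 := h.subset_annulus x hx
      have h2 := h.subset_annulus y hy
      cases k with
      | expanding =>
        simp only [HypKind.lshift, HypKind.rshift, one_mul, zero_mul, sub_zero]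
        exact ⟨h2.2.1.le, h1.1.2.le⟩
      | attracting =>
        simp only [HypKind.lshift, HypKind.rshift, one_mul, zero_mul, sub_zero]
        exact ⟨h2.1.1.le, h1.2.2.le⟩) he0
  choose! W hWd hW using hsh
  set U := ball c₀ (min ρ (min ε (min ε₁ ε₂))) with hU
  have hUρ : ∀ c ∈ U, c ∈ ball c₀ ρ := fun c hc => ball_subset_ball (min_le_left _ _) hc
  have hU' : ∀ c ∈ U, ‖c - c₀‖ < ε ∧ ‖c - c₀‖ < ε₁ ∧ ‖c - c₀‖ < ε₂ := by
    intro c hc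
    rw [hU, mem_ball, dist_eq_norm] at hc
    simp only [lt_min_iff] at hc
    exact hc.2
  let w : ℂ → (ℕ → ℂ) → ℂ := fun c x => W x 0 c
  have hclose : ∀ c ∈ U, ∀ x ∈ orbits p q k c₀ Λ, ∀ i, ‖W x i c - x i‖ < ε := fun c hc x hx i =>
    ((hW x hx c (hUρ c hc)).2 i).trans_le (by linarith)
  have hbase : c₀ ∈ U := mem_ball_self (by positivity)
  -- The shadows of different orbits were chosen separately; uniqueness identifies the shadow of a
  -- shift with the shift of the shadow.
  have htail : ∀ c ∈ U, ∀ x ∈ orbits p q k c₀ Λ, trace w c x = fun i => W x i c := by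
    intro c hc x hx
    funext i
    have hx' := tail_mem_orbits hx i
    have h1 := hcon.shadow_unique hx' (hU' c hc).1 (hW _ hx' c (hUρ c hc)).1
      (u' := tail i fun i => W x i c) (fun j => by
        have := (hW x hx c (hUρ c hc)).1 (j + i)
        rwa [add_right_comm] at this) (hclose c hc _ hx') fun j => hclose c hc x hx (j + i)
    have h2 := congrFun h1 0
    simpa [trace, w] using h2
  have hstep : ∀ c ∈ U, ∀ x ∈ orbits p q k c₀ Λ, Step p q k c (w c x) (w c (tail 1 x)) := by
    intro c hc x hx
    have h1 := (hW x hx c (hUρ c hc)).1 0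
    have h2 := congrFun (htail c hc x hx) 1
    rw [zero_add, ← h2] at h1
    exact h1
  have hnear : ∀ c ∈ U, ∀ z ∈ w c '' orbits p q k c₀ Λ, ∃ x ∈ Λ, ‖z - x‖ < min ε₁ ε₂ := by
    rintro c hc _ ⟨x, hx, rfl⟩
    exact ⟨x 0, hx.1 0, ((hW x hx c (hUρ c hc)).2 0).trans_le (min_le_right _ _)⟩
  have hsc : ∀ c ∈ U, IsBundleScale p q c (w c '' orbits p q k c₀ Λ) r δ := fun c hc =>
    hscale c (hU' c hc).2.1 _ fun z hz => by
      obtain ⟨x, hx, hzx⟩ := hnear c hc z hz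
      exact ⟨x, hx, hzx.trans_le (min_le_left _ _)⟩
  have hne : (orbits p q k c₀ Λ).Nonempty := by
    obtain ⟨x, hx, -⟩ := exists_orbit hinv k hinv.nonempty.some_mem
    exact ⟨x, hx⟩
  have hcompact : ∀ c ∈ U, IsCompact (w c '' orbits p q k c₀ Λ) := by
    intro c hc
    -- Continuity of `w c` is not available, so its image is identified with the compact set of
    -- initial points of all shadows.
    convert isCompact_shadows (p := p) (q := q) hinv.compact k c₀ c e using 1
    ext z
    constructor
    · rintro ⟨x, hx, rfl⟩
      exact ⟨x, hx, fun i => W x i c, fun i => ((hW x hx c (hUρ c hc)).2 i).le,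
        (hW x hx c (hUρ c hc)).1, rfl⟩
    · rintro ⟨x, hx, u, h1, h2, rfl⟩
      refine ⟨x, hx, ?_⟩
      have h3 := hcon.shadow_unique hx (hU' c hc).1 (hW x hx c (hUρ c hc)).1 h2
        (hclose c hc x hx) fun i => (h1 i).trans_lt (by linarith)
      exact congrFun h3 0
  refine ⟨U, w, ⟨isBounded_ball, isOpen_ball, isConnected_ball (by positivity), hbase, ?_, hstep,
    ?_, ?_, ?_, ?_⟩, hsc⟩
  · intro x hx
    have h1 := hcon.shadow_unique hx (hU' c₀ hbase).1 (hW x hx c₀ (hUρ c₀ hbase)).1 hx.2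
      (hclose c₀ hbase x hx) fun i => by simpa using hε
    exact congrFun h1 0
  · intro c hc x hx y hy hxy
    rw [htail c hc x hx, htail c hc y hy] at hxy
    -- Here `x` and `y` are themselves regarded as orbits for `c₀` that shadow `x`.
    refine hcon.shadow_unique hx (hU' c₀ hbase).1 hx.2 hy.2 (fun i => by simpa using hε) fun i => ?_
    have h1 := (hW x hx c (hUρ c hc)).2 i
    have h2 := (hW y hy c (hUρ c hc)).2 i
    have h3 : W x i c = W y i c := congrFun hxy i
    rw [← h3] at h2
    calc ‖y i - x i‖ = ‖(W x i c - x i) - (W x i c - y i)‖ := by ring_nf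
      _ ≤ ‖W x i c - x i‖ + ‖W x i c - y i‖ := norm_sub_le _ _
      _ < ε := by linarith
  · exact fun x hx => (hWd x hx 0).mono hUρ
  · intro c hc
    refine hhyp c (hU' c hc).2.2 _ (fun z hz => ?_) (isSemiInvariant_of_steps (k := k)
      (hne.image _) (hcompact c hc) (fun h0 => (hsc c hc).ne_zero h0 rfl) ?_ ?_)
    · obtain ⟨x, hx, hzx⟩ := hnear c hc z hz
      exact ⟨x, hx, hzx.trans_le (min_le_right _ _)⟩
    · rintro _ ⟨x, hx, rfl⟩
      exact ⟨_, mem_image_of_mem _ (tail_mem_orbits hx 1), hstep c hc x hx⟩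
    · rintro _ ⟨x, hx, rfl⟩
      obtain ⟨y, hy, rfl⟩ := exists_orbit_extension hinv hx
      exact ⟨_, mem_image_of_mem _ hy, hstep c hc y hy⟩
  · refine ⟨B / (1 - l) / m, by positivity, fun u hu v hv x hx => ?_⟩
    have h1 := hcon.dist_shadows_le hx (hU' u hu).1 (hU' v hv).1 (hW x hx u (hUρ u hu)).1
      (hW x hx v (hUρ v hv)).1 (hclose u hu x hx) (hclose v hv x hx) 0
    rw [← le_div_iff₀' hm] at h1
    refine h1.trans_eq ?_
    ring

end PowerCorr

/-! ### Comparison of bundle motions and the main theorem -/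

namespace PowerCorr

variable {p q : ℕ} {k : HypKind} {c₀ : ℂ} {Λ : Set ℂ} {r δ r' δ' : ℝ}
variable {S : Set (ℂ × ℂ)} {U U' W : Set ℂ} {h h' : ℂ → ℂ × ℂ → ℂ × ℂ}

/-- Bundle motions, possibly for different scales, induce the same multifunction. -/
theorem IsBundleMotion.inducedMulti_eq (hq : 2 ≤ q) (hpq : q < p)
    (h0 : IsBundleScale p q c₀ Λ r δ) (h0' : IsBundleScale p q c₀ Λ r' δ')
    (hS : IsSolenoidalExtension p q k c₀ Λ r δ S) (hh : IsBundleMotion p q k c₀ Λ r δ U h)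
    (hh' : IsBundleMotion p q k c₀ Λ r' δ' U' h') (hW : IsConnected W) (hc₀ : c₀ ∈ W)
    (hWU : W ⊆ U ∩ U') {c : ℂ} (hc : c ∈ W) (z : ℂ) :
    inducedMulti S h c z = inducedMulti (changeScale p q k c₀ Λ r δ r' δ' '' S) h' c z := by
  rw [PowerCorr.inducedMulti_eq h0 hS.subset,
    PowerCorr.inducedMulti_eq h0' (hS.changeScale h0 h0').subset,
    codedOrbits_changeScale h0 h0' hS.subset]
  have hw : ∀ x ∈ codedOrbits p q k c₀ Λ r δ S, orbitPart r δ h c x = orbitPart r' δ' h' c x :=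
    fun x hx => (hh.isOrbitMotion h0).unique hq hpq (hh'.isOrbitMotion h0') hW hc₀ hWU hc
      (codedOrbits_subset h0 hS.subset hx)
  ext v
  constructor
  · rintro ⟨x, hx, h1, h2⟩
    exact ⟨x, hx, h1, by rw [← hw x hx, h2]⟩
  · rintro ⟨x, hx, h1, h2⟩
    exact ⟨x, hx, h1, by rw [hw x hx, h2]⟩

/-- This makes uniqueness the special case `(r', δ') = (r, δ)` of independence of the scale. -/
theorem changeScale_self_image (h0 : IsBundleScale p q c₀ Λ r δ)
    (hS : S ⊆ cantorBundle p q k c₀ Λ r δ) : changeScale p q k c₀ Λ r δ r δ '' S = S := by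
  have h1 : ∀ y ∈ S, changeScale p q k c₀ Λ r δ r δ y = id y := fun y hy => by
    rw [changeScale_eq, h0.encode_decode (hS hy), id]
  rw [image_congr h1, image_id]

end PowerCorr

theorem theorem3p2 (p q : ℕ) (hq : 2 ≤ q) (hpq : q < p) (k : PowerCorr.HypKind) (c₀ : ℂ)
    (Λ : Set ℂ) (hΛ : PowerCorr.IsHyperbolicSet p q k c₀ Λ)
    (r δ : ℝ) (hrδ : PowerCorr.IsBundleScale p q c₀ Λ r δ)
    (S : Set (ℂ × ℂ)) (hS : PowerCorr.IsSolenoidalExtension p q k c₀ Λ r δ S) :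
    -- the motion that defines the induced multifunction exists
    (∃ (U : Set ℂ) (h : ℂ → ℂ × ℂ → ℂ × ℂ), PowerCorr.IsBundleMotion p q k c₀ Λ r δ U h) ∧
    -- the induced multifunction is a normal branched holomorphic motion
    (∀ (U : Set ℂ) (h : ℂ → ℂ × ℂ → ℂ × ℂ), PowerCorr.IsBundleMotion p q k c₀ Λ r δ U h →
      PowerCorr.IsNormalBranchedMotion U Λ c₀ (PowerCorr.inducedMulti S h)) ∧
    -- it does not depend on the choice of the scale of the Cantor bundle
    (∀ r' δ' : ℝ, PowerCorr.IsBundleScale p q c₀ Λ r' δ' →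
      PowerCorr.IsSolenoidalExtension p q k c₀ Λ r' δ'
        (PowerCorr.changeScale p q k c₀ Λ r δ r' δ' '' S) ∧
      (∀ (U : Set ℂ) (h : ℂ → ℂ × ℂ → ℂ × ℂ), PowerCorr.IsBundleMotion p q k c₀ Λ r δ U h →
        (∀ c ∈ U, PowerCorr.IsBundleScale p q c
          (PowerCorr.movedSet p q k c₀ Λ r δ h c) r' δ') →
        ∃ h' : ℂ → ℂ × ℂ → ℂ × ℂ, PowerCorr.IsBundleMotion p q k c₀ Λ r' δ' U h') ∧
      (∀ (U U' : Set ℂ) (h h' : ℂ → ℂ × ℂ → ℂ × ℂ),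
        PowerCorr.IsBundleMotion p q k c₀ Λ r δ U h →
        PowerCorr.IsBundleMotion p q k c₀ Λ r' δ' U' h' →
        ∀ W : Set ℂ, IsConnected W → c₀ ∈ W → W ⊆ U ∩ U' → ∀ c ∈ W, ∀ z ∈ Λ,
          PowerCorr.inducedMulti S h c z =
            PowerCorr.inducedMulti (PowerCorr.changeScale p q k c₀ Λ r δ r' δ' '' S) h' c z)) ∧
    -- it is unique up to extensions of the parameter domain
    (∀ (U U' : Set ℂ) (h h' : ℂ → ℂ × ℂ → ℂ × ℂ),
      PowerCorr.IsBundleMotion p q k c₀ Λ r δ U h →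
      PowerCorr.IsBundleMotion p q k c₀ Λ r δ U' h' →
      ∀ W : Set ℂ, IsConnected W → c₀ ∈ W → W ⊆ U ∩ U' → ∀ c ∈ W, ∀ z ∈ Λ,
        PowerCorr.inducedMulti S h c z = PowerCorr.inducedMulti S h' c z) := by
  refine ⟨?_, fun U h hh => hh.isNormalBranchedMotion hS, fun r' δ' h' => ⟨hS.changeScale hrδ h',
    fun U h hh hs => ?_, fun U U' h₁ h₂ hh₁ hh₂ W hW h0 hWU c hc z _ =>
      hh₁.inducedMulti_eq hq hpq hrδ h' hS hh₂ hW h0 hWU hc z⟩,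
    fun U U' h₁ h₂ hh₁ hh₂ W hW h0 hWU c hc z _ => ?_⟩
  · obtain ⟨U, w, hw, hs⟩ := hΛ.exists_isOrbitMotion hq hpq hrδ
    exact ⟨U, _, hw.isBundleMotion hΛ.1 hrδ hs⟩
  -- The given motion is reduced to a motion of orbits and lifted again at the new scale, over the
  -- same `U`.
  · refine ⟨_, (hh.isOrbitMotion hrδ).isBundleMotion hΛ.1 h' fun c hc => ?_⟩
    rw [PowerCorr.image_orbitPart hrδ]
    exact hs c hc
  · rw [hh₁.inducedMulti_eq hq hpq hrδ hrδ hS hh₂ hW h0 hWU hc z,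
      PowerCorr.changeScale_self_image hrδ hS.subset]
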